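/- Let $n\ge 0$ be an integer, let $(p_j)_{1\le j\le n}$ and $(\gamma_j)_{1\le j\le n}$ be real parameters, and let $A>0$. There exists a constant $C$, depending only on $n$, $(p_j)$, $(\gamma_j)$ and $A$, such that the following holds. Let $d\ge 0$, let $K\subset\mathbb{R}^d$ be compact, and let $X$ and $Y$ be two centered continuous Gaussian fields on $K$, possibly defined on different probability spaces, satisfying $$ \big|\mathbb{E}[X(x)X(y)]-\mathbb{E}[Y(x)Y(y)]\big|\le A\qquad\text{for all }x,y\in K . $$ (A continuous Gaussian field is a Gaussian process indexed by $K$ whose sample paths are almost surely continuous.) Then for any Radon measures $\mu_1,\dots,\mu_n$ on $K$, both expectations below are finite and $$ \mathbb{E}\Big[\prod_{j=1}^n\Big(\int_K e^{\gamma_j X(x)-\frac{\gamma_j^2}{2}\mathbb{E}[X(x)^2]}\,\mu_j(\mathrm{d}x)\Big)^{p_j}\Big] \le C\,\mathbb{E}\Big[\prod_{j=1}^n\Big(\int_K e^{\gamma_j Y(x)-\frac{\gamma_j^2}{2}\mathbb{E}[Y(x)^2]}\,\mu_j(\mathrm{d}x)\Big)^{p_j}\Big]. $$ Here, in the degenerate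 case $\mu_j=0$, the convention is $0^0=1$ and $0^p=0$ for $p\ne 0$. -/

import Mathlib

open MeasureTheory ProbabilityTheory

/-- A (centered) continuous Gaussian field on a topological space `T`, defined on `(Ω, P)`:
all finite-dimensional marginals are Gaussian, all means vanish, and almost every sample path
is continuous. -/
structure IsContinuousGaussianField {T Ω : Type*} [TopologicalSpace T] [MeasurableSpace Ω]
    (X : T → Ω → ℝ) (P : Measure Ω) : Prop where
  gaussian : IsGaussianProcess X P
  centered : ∀ x, ∫ ω, X x ω ∂P = 0
  continuous : ∀ᵐ ω ∂P, Continuous fun x => X x ω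

/-- The random total mass `∫ exp (γ X(x) - (γ² / 2) E[X(x)²]) μ(dx)`. -/
noncomputable def expMass {T Ω : Type*} [MeasurableSpace T] [MeasurableSpace Ω]
    (P : Measure Ω) (X : T → Ω → ℝ) (γ : ℝ) (μ : Measure T) (ω : Ω) : ℝ :=
  ∫ x, Real.exp (γ * X x ω - γ ^ 2 / 2 * ∫ ω', X x ω' ^ 2 ∂P) ∂μ

/-- The random product `∏ j, (∫ exp (γ_j X(x) - (γ_j² / 2) E[X(x)²]) μ_j(dx)) ^ p_j`. -/
noncomputable def expMassProd {T Ω : Type*} [MeasurableSpace T] [MeasurableSpace Ω] {n : ℕ}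
    (P : Measure Ω) (X : T → Ω → ℝ) (γ p : Fin n → ℝ) (μ : Fin n → Measure T) (ω : Ω) : ℝ :=
  ∏ j, expMass P X (γ j) (μ j) ω ^ p j

/-! The proof exchanges small Gaussian increments. Seen as a centered Gaussian law on `C(K, ℝ)`,
each field is, by rotation invariance, a sum of `N` independent copies scaled by `ε = 1/√N`. The
increments of `X` are replaced by those of `Y` one at a time (`lintegral_lintegral_sqrt_add_le`).
When the rest of the sum is frozen, its exponential only tilts the measures: `massProd_add` pulls
out a nonnegative factor and leaves the same product for a field of size `ε` and probability
measures.

The expectation of that product is `1 + ε² c + O(ε³)`, uniformly in the measures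
(`exists_abs_integral_massProd_sub_le`), and `c` is linear in averages of the covariance.
Covariances within `A` of each other change `c` by at most `κ/2`, with `κ` depending only on `p`,
`γ`, `A`. One exchange thus costs a factor at most `1 + (κ + 2) ε²` (`exists_integral_massProd_le`),
and `N = 1/ε²` exchanges cost at most `exp (κ + 2)`. How small `ε` must be depends on the fields,
but this final bound does not. -/

/-! ### From Gaussian fields to Gaussian laws on `C(K, ℝ)` -/

open Filter Topology in
/-- Almost sure limits of centered real Gaussian variables are centered Gaussian. -/
theorem exists_map_eq_gaussianReal_of_tendsto {Ω : Type*} [MeasurableSpace Ω] {P : Measure Ω}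
    [IsProbabilityMeasure P] {Z : ℕ → Ω → ℝ} {W : Ω → ℝ}
    (hZ : ∀ n, ∃ v, P.map (Z n) = gaussianReal 0 v)
    (hW : ∀ᵐ ω ∂P, Tendsto (fun n => Z n ω) atTop (𝓝 (W ω))) :
    ∃ v, P.map W = gaussianReal 0 v := by
  choose v hv using hZ
  have hZm : ∀ n, AEMeasurable (Z n) P := fun n =>
    AEMeasurable.of_map_ne_zero (by rw [hv n]; exact IsProbabilityMeasure.ne_zero _)
  have hWm : AEMeasurable W P := aemeasurable_of_tendsto_metrizable_ae' hZm hW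
  have : IsProbabilityMeasure (P.map W) := Measure.isProbabilityMeasure_map hWm
  have hchar : ∀ {U : Ω → ℝ}, AEMeasurable U P → ∀ t : ℝ,
      charFun (P.map U) t = ∫ ω, Complex.exp (t * U ω * Complex.I) ∂P := by
    intro U hU t
    rw [charFun_apply_real, integral_map hU (by fun_prop)]
  have hlim : ∀ t : ℝ, Tendsto (fun n => charFun (P.map (Z n)) t) atTop
      (𝓝 (charFun (P.map W) t)) := by
    intro t
    simp_rw [hchar hWm, fun n => hchar (hZm n)]
    refine tendsto_integral_of_dominated_convergence (fun _ => 1) ?_ (integrable_const _) ?_ ?_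
    · intro n
      have := hZm n
      exact (by fun_prop : AEMeasurable _ P).aestronglyMeasurable
    · intro n
      filter_upwards with ω
      rw [← Complex.ofReal_mul, Complex.norm_exp_ofReal_mul_I]
    · filter_upwards [hW] with ω hω
      have hc : Continuous fun u : ℝ => Complex.exp (t * u * Complex.I) := by fun_prop
      exact (hc.tendsto _).comp hω
  -- `c n` is the characteristic function at `1`; its value at `t` is `c n ^ (t ^ 2)`, so the limit
  -- at `t = 1` determines all the others.
  set c : ℕ → ℝ := fun n => Real.exp (-(v n) / 2) with hc
  have hcpos : ∀ n, 0 < c n := fun n => Real.exp_pos _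
  have hZc : ∀ n (t : ℝ), charFun (P.map (Z n)) t = ((c n ^ (t ^ 2) : ℝ) : ℂ) := by
    intro n t
    rw [hv n, charFun_gaussianReal, hc, ← Real.exp_mul]
    push_cast
    congr 1
    ring
  simp_rw [hZc] at hlim
  have hre : ∀ t : ℝ, Tendsto (fun n => c n ^ (t ^ 2)) atTop (𝓝 (charFun (P.map W) t).re) := by
    intro t
    simpa [Function.comp_def] using (Complex.continuous_re.tendsto _).comp (hlim t)
  set a := (charFun (P.map W) 1).re with ha
  have hca : Tendsto c atTop (𝓝 a) := by simpa using hre 1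
  have ha0 : 0 ≤ a := ge_of_tendsto' hca fun n => (hcpos n).le
  have ha1 : a ≤ 1 := le_of_tendsto' hca fun n => by
    have := (v n).coe_nonneg
    exact Real.exp_le_one_iff.2 (by linarith)
  have hchW : ∀ t : ℝ, t ≠ 0 → charFun (P.map W) t = ((a ^ (t ^ 2) : ℝ) : ℂ) := by
    intro t ht
    refine tendsto_nhds_unique (hlim t) ?_
    have h2 : 0 < t ^ 2 := by positivity
    exact (Complex.continuous_ofReal.tendsto _).comp
      ((Real.continuousAt_rpow_const a (t ^ 2) (Or.inr h2.le)).tendsto.comp hca)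
  -- The variances cannot blow up: with `a = 0` the limit would vanish off `0` and equal `1` at `0`,
  -- against continuity.
  have hapos : 0 < a := by
    refine lt_of_le_of_ne ha0 fun h0 => ?_
    have hcont : Tendsto (fun t : ℝ => charFun (P.map W) t) (𝓝[≠] 0) (𝓝 1) := by
      have := (continuous_charFun (μ := P.map W)).tendsto (0 : ℝ)
      simp only [charFun_zero, probReal_univ, Complex.ofReal_one] at this
      exact this.mono_left nhdsWithin_le_nhds
    have h0' : Tendsto (fun t : ℝ => charFun (P.map W) t) (𝓝[≠] 0) (𝓝 0) := by
      refine tendsto_const_nhds.congr' ?_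
      filter_upwards [self_mem_nhdsWithin] with t ht
      have ht2 : t ^ 2 ≠ 0 := pow_ne_zero _ ht
      rw [hchW t ht, ← h0, Real.zero_rpow ht2, Complex.ofReal_zero]
    exact one_ne_zero (tendsto_nhds_unique hcont h0')
  have hv0 : 0 ≤ -2 * Real.log a := by have := Real.log_nonpos ha0 ha1; linarith
  refine ⟨(-2 * Real.log a).toNNReal, ?_⟩
  refine Measure.ext_of_charFun ?_
  ext t
  rw [charFun_gaussianReal]
  rcases eq_or_ne t 0 with rfl | ht
  · simp
  · rw [hchW t ht, Real.rpow_def_of_pos hapos]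
    rw [Real.coe_toNNReal _ hv0]
    push_cast
    congr 1
    ring

/-- On a compact metric space, continuous functions are uniform limits of finite-rank
interpolations at finitely many points. -/
theorem exists_interpolation_tendsto (K : Type*) [MetricSpace K] [CompactSpace K] :
    ∃ (s : ℕ → Finset K) (ψ : ℕ → K → C(K, ℝ)), ∀ f : C(K, ℝ),
      Filter.Tendsto (fun n => ∑ x ∈ s n, f x • ψ n x) Filter.atTop (nhds f) := by
  have key : ∀ n : ℕ, ∃ (s : Finset K) (ψ : K → C(K, ℝ)), ∀ f : C(K, ℝ), ∀ δ > 0,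
      (∀ x y, dist x y < 1 / ((n : ℝ) + 1) → |f x - f y| ≤ δ) →
      ‖∑ x ∈ s, f x • ψ x - f‖ ≤ δ := by
    intro n
    have hpos : (0 : ℝ) < 1 / ((n : ℝ) + 1) := by positivity
    obtain ⟨s, -, hs⟩ := (isCompact_univ (X := K)).elim_nhds_subcover
      (fun x => Metric.ball x (1 / ((n : ℝ) + 1))) fun x _ => Metric.ball_mem_nhds x hpos
    obtain ⟨ρ, hρ⟩ := PartitionOfUnity.exists_isSubordinate (X := K) (s := Set.univ) isClosed_univ
      (fun x : s => Metric.ball (x : K) (1 / ((n : ℝ) + 1))) (fun _ => Metric.isOpen_ball)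
      (by intro x hx; simpa using hs hx)
    classical
    refine ⟨s, fun x => if h : x ∈ s then ρ ⟨x, h⟩ else 0, fun f δ hδ hf => ?_⟩
    rw [ContinuousMap.norm_le _ hδ.le]
    intro y
    have h1 : ∑ x : s, ρ x y = 1 := by
      rw [← finsum_eq_sum_of_fintype]; exact ρ.sum_eq_one (Set.mem_univ y)
    -- Since the weights sum to one, the error at `y` is a weighted average of `f x - f y` over
    -- nodes `x` close to `y`.
    have h2 : (∑ x ∈ s, f x • (if h : x ∈ s then ρ ⟨x, h⟩ else 0 : C(K, ℝ)) - f) y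
        = ∑ x : s, ρ x y * (f x - f y) := by
      rw [← Finset.sum_coe_sort s]
      simp only [ContinuousMap.sub_apply, ContinuousMap.sum_apply, ContinuousMap.smul_apply,
        smul_eq_mul, mul_sub, Finset.sum_sub_distrib, ← Finset.sum_mul, h1, one_mul]
      congr 1
      refine Finset.sum_congr rfl fun x _ => ?_
      simp [mul_comm]
    rw [h2]
    calc ‖∑ x : s, ρ x y * (f x - f y)‖ ≤ ∑ x : s, ρ x y * δ := by
          refine norm_sum_le_of_le _ fun x _ => ?_
          rw [norm_mul, Real.norm_of_nonneg (ρ.nonneg x y)]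
          by_cases hxy : ρ x y = 0
          · simp [hxy]
          · refine mul_le_mul_of_nonneg_left (hf _ _ ?_) (ρ.nonneg x y)
            have := hρ x (subset_tsupport _ (Function.mem_support.2 hxy))
            rwa [Metric.mem_ball, dist_comm] at this
      _ = δ := by rw [← Finset.sum_mul, h1, one_mul]
  choose s ψ h using key
  refine ⟨s, ψ, fun f => ?_⟩
  rw [Metric.tendsto_atTop]
  intro δ hδ
  obtain ⟨η, hη, hf⟩ := Metric.uniformContinuous_iff.1
    (CompactSpace.uniformContinuous_of_continuous f.continuous) (δ / 2) (half_pos hδ)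
  obtain ⟨N, hN⟩ := exists_nat_one_div_lt hη
  refine ⟨N, fun n hn => ?_⟩
  rw [dist_eq_norm]
  refine (h n f (δ / 2) (half_pos hδ) fun x y hxy => ?_).trans_lt (half_lt_self hδ)
  rw [← Real.dist_eq]
  exact (hf (hxy.trans_le ((Nat.one_div_le_one_div hn).trans hN.le))).le

/-- A continuous Gaussian field on a compact metric space has the same paths, almost surely, as a
random element of `C(K, ℝ)` with centered Gaussian law. -/
theorem IsContinuousGaussianField.exists_path {K Ω : Type*} [MetricSpace K] [CompactSpace K]
    [MeasurableSpace C(K, ℝ)] [BorelSpace C(K, ℝ)] [MeasurableSpace Ω] {P : Measure Ω}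
    [IsProbabilityMeasure P] {X : K → Ω → ℝ} (hX : IsContinuousGaussianField X P) :
    ∃ φ : Ω → C(K, ℝ), AEMeasurable φ P ∧ (∀ᵐ ω ∂P, ∀ x, φ ω x = X x ω) ∧
      IsGaussian (P.map φ) ∧ ∀ x, ∫ f, f x ∂(P.map φ) = 0 := by
  classical
  obtain ⟨s, ψ, hψ⟩ := exists_interpolation_tendsto K
  -- The value `0` is used only on the null set of discontinuous paths.
  let φ : Ω → C(K, ℝ) := fun ω =>
    if h : Continuous fun x => X x ω then ⟨fun x => X x ω, h⟩ else 0
  have hφ : ∀ᵐ ω ∂P, ∀ x, φ ω x = X x ω := by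
    filter_upwards [hX.continuous] with ω hω x
    simp [φ, hω]
  have hXm : ∀ x, AEMeasurable (X x) P := hX.gaussian.aemeasurable
  have hlim : ∀ᵐ ω ∂P, Filter.Tendsto (fun n => ∑ x ∈ s n, X x ω • ψ n x) Filter.atTop
      (nhds (φ ω)) := by
    filter_upwards [hφ] with ω hω
    simpa only [hω] using hψ (φ ω)
  have hφm : AEMeasurable φ P :=
    aemeasurable_of_tendsto_metrizable_ae' (fun n => by
      refine Finset.aemeasurable_fun_sum _ fun x _ => ?_
      have hc : Continuous fun u : ℝ => u • ψ n x := by fun_prop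
      exact hc.measurable.comp_aemeasurable (hXm x)) hlim
  have hcomb : ∀ (t : Finset K) (c : K → ℝ), ∃ v,
      P.map (fun ω => ∑ x ∈ t, X x ω * c x) = gaussianReal 0 v := by
    intro t c
    let L : (t → ℝ) →L[ℝ] ℝ := ∑ x : t, c x • ContinuousLinearMap.proj x
    have hL : (fun ω => ∑ x ∈ t, X x ω * c x) = fun ω => L (t.restrict fun x => X x ω) := by
      ext ω
      rw [← Finset.sum_coe_sort t]
      simp [L, mul_comm]
    have hg : HasGaussianLaw (fun ω => ∑ x ∈ t, X x ω * c x) P := by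
      rw [hL]
      exact (hX.gaussian.hasGaussianLaw t).map_fun L
    refine ⟨Var[fun ω => ∑ x ∈ t, X x ω * c x; P].toNNReal, ?_⟩
    rw [hg.map_eq_gaussianReal]
    congr 1
    rw [integral_finsetSum]
    · simp [integral_mul_const, hX.centered]
    · intro x _
      exact ((hX.gaussian.hasGaussianLaw_eval x).integrable).mul_const _
  refine ⟨φ, hφm, hφ, ?_, fun x => ?_⟩
  -- By interpolation, `L ∘ φ` is an almost sure limit of finite linear combinations of the `X x`,
  -- which are centered Gaussian.
  · refine isGaussian_of_map_eq_gaussianReal fun L => ⟨0, ?_⟩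
    rw [AEMeasurable.map_map_of_aemeasurable (by fun_prop) hφm]
    refine exists_map_eq_gaussianReal_of_tendsto (fun n => hcomb (s n) fun x => L (ψ n x)) ?_
    filter_upwards [hlim] with ω hω
    simpa [Function.comp_def] using (L.continuous.tendsto _).comp hω
  · rw [integral_map hφm (by
      exact (continuous_eval_const (F := C(K, ℝ)) x).aestronglyMeasurable), ← hX.centered x]
    refine integral_congr_ae ?_
    filter_upwards [hφ] with ω hω using hω x

/-! ### Exponential moments and rotation invariance -/

section GaussianLaw

variable {E : Type*} [NormedAddCommGroup E] [NormedSpace ℝ E] [MeasurableSpace E] [BorelSpace E]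
  [SecondCountableTopology E] [CompleteSpace E]

/-- Gaussian measures have exponential moments of all orders. -/
theorem integrable_exp_mul_norm_of_isGaussian (μ : Measure E) [IsGaussian μ] (c : ℝ) :
    Integrable (fun f => Real.exp (c * ‖f‖)) μ := by
  -- Fernique's theorem; completing the square then absorbs the linear term.
  obtain ⟨C, hC, hint⟩ := IsGaussian.exists_integrable_exp_sq μ
  refine (hint.const_mul (Real.exp (c ^ 2 / (4 * C)))).mono' (by fun_prop) ?_
  filter_upwards with f
  rw [Real.norm_of_nonneg (Real.exp_pos _).le, ← Real.exp_add, Real.exp_le_exp]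
  have h : c ^ 2 / (4 * C) + C * ‖f‖ ^ 2 - c * ‖f‖ = (c - 2 * C * ‖f‖) ^ 2 / (4 * C) := by
    field_simp
    ring
  have : 0 ≤ (c - 2 * C * ‖f‖) ^ 2 / (4 * C) := by positivity
  linarith

/-- Stability of centered Gaussian measures under rotations. -/
theorem lintegral_eq_lintegral_lintegral_sqrt (μ : Measure E) [IsGaussian μ] (h0 : μ[id] = 0)
    {G : E → ENNReal} (hG : Measurable G) {s t : ℝ} (hs : 0 ≤ s) (ht : 0 ≤ t) :
    ∫⁻ f, G (√(s + t) • f) ∂μ = ∫⁻ f, ∫⁻ g, G (√s • f + √t • g) ∂μ ∂μ := by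
  rcases eq_or_lt_of_le (add_nonneg hs ht) with h | h
  · obtain rfl : s = 0 := by linarith
    obtain rfl : t = 0 := by linarith
    simp
  set a := √s / √(s + t) with ha
  set b := √t / √(s + t) with hb
  have hr : 0 < √(s + t) := Real.sqrt_pos.2 h
  have ha0 : 0 ≤ a := by positivity
  have hb0 : 0 ≤ b := by positivity
  have hab : a ^ 2 + b ^ 2 = 1 := by
    rw [ha, hb, div_pow, div_pow, Real.sq_sqrt hs, Real.sq_sqrt ht, Real.sq_sqrt h.le, ← add_div,
      div_self h.ne']
  -- `a` and `b` are the cosine and sine of one angle, and the rotation by it preserves `μ ⊗ μ`.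
  have hcos : Real.cos (Real.arccos a) = a :=
    Real.cos_arccos (by linarith) (by nlinarith [sq_nonneg b])
  have hsin : Real.sin (Real.arccos a) = b := by
    rw [Real.sin_arccos, show 1 - a ^ 2 = b ^ 2 by linarith, Real.sqrt_sq hb0]
  have hrot := IsGaussian.map_rotation_eq_self h0 (μ := μ) (Real.arccos a)
  calc ∫⁻ f, G (√(s + t) • f) ∂μ
      = ∫⁻ q, G (√(s + t) • q.1) ∂(μ.prod μ) := by
        rw [lintegral_prod _ (by fun_prop)]
        simp
    _ = ∫⁻ q, G (√(s + t) • q.1) ∂((μ.prod μ).map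
          (ContinuousLinearMap.rotation (Real.arccos a))) := by rw [hrot]
    _ = ∫⁻ q, G (√s • q.1 + √t • q.2) ∂(μ.prod μ) := by
        rw [lintegral_map (by fun_prop) (by fun_prop)]
        refine lintegral_congr fun q => ?_
        rw [ContinuousLinearMap.rotation_apply, hcos, hsin, smul_add, smul_smul, smul_smul, ha, hb,
          mul_div_cancel₀ _ hr.ne', mul_div_cancel₀ _ hr.ne']
    _ = _ := lintegral_prod _ (by fun_prop)

end GaussianLaw

/-- A Gaussian measure on `C(K, ℝ)` with vanishing one-point means has mean zero. -/
theorem integral_id_eq_zero_of_forall_eval {K : Type*} [TopologicalSpace K] [CompactSpace K]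
    [MeasurableSpace C(K, ℝ)] [BorelSpace C(K, ℝ)] [SecondCountableTopology C(K, ℝ)]
    (μ : Measure C(K, ℝ)) [IsGaussian μ] (h0 : ∀ x, ∫ f, f x ∂μ = 0) : μ[id] = 0 := by
  ext x
  have := (ContinuousMap.evalCLM ℝ x : C(K, ℝ) →L[ℝ] ℝ).integral_comp_comm
    (IsGaussian.integrable_id (μ := μ))
  simp only [id_eq, ContinuousMap.evalCLM_apply, h0] at this
  simpa using this.symm

/-! ### Error terms with exponential or affine growth -/

section ExpBigO

variable {ι : Type*}

/-- `H` is `O(ε ^ k)` up to a factor which is exponential in `b`. -/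
def ExpBigO (ε b : ι → ℝ) (k : ℕ) (H : ι → ℝ) : Prop :=
  ∃ C, 0 ≤ C ∧ ∀ i, |H i| ≤ C * ε i ^ k * Real.exp (C * b i)

/-- `H` is `O(ε)` up to a factor which is affine in `b`. -/
def AffineBigO (ε b : ι → ℝ) (H : ι → ℝ) : Prop :=
  ∃ C, 0 ≤ C ∧ ∀ i, |H i| ≤ C * ε i * (1 + b i)

variable {ε b : ι → ℝ} {H G : ι → ℝ} {k l : ℕ}

theorem ExpBigO.congr (h : ExpBigO ε b k H) (hHG : ∀ i, G i = H i) : ExpBigO ε b k G :=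
  (funext hHG : G = H) ▸ h

/-- The definition uses one constant as both prefactor and rate; here the two may differ. -/
theorem ExpBigO.of_le (hε : ∀ i, 0 ≤ ε i) (hb : ∀ i, 0 ≤ b i) {C D : ℝ}
    (hC : 0 ≤ C) (h : ∀ i, |H i| ≤ C * ε i ^ k * Real.exp (D * b i)) : ExpBigO ε b k H := by
  refine ⟨max C D, hC.trans (le_max_left _ _), fun i => (h i).trans ?_⟩
  have := hε i
  have := hb i
  gcongr
  · exact le_max_left _ _
  · exact le_max_right _ _

theorem ExpBigO.add (hε : ∀ i, 0 ≤ ε i) (hb : ∀ i, 0 ≤ b i) (h : ExpBigO ε b k H)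
    (h' : ExpBigO ε b k G) : ExpBigO ε b k fun i => H i + G i := by
  obtain ⟨C, hC, hH⟩ := h
  obtain ⟨D, hD, hG⟩ := h'
  refine .of_le hε hb (add_nonneg hC hD) (D := max C D) fun i => ?_
  have h1 := hε i
  have h2 := hb i
  calc |H i + G i| ≤ |H i| + |G i| := abs_add_le _ _
    _ ≤ C * ε i ^ k * Real.exp (max C D * b i) + D * ε i ^ k * Real.exp (max C D * b i) := by
        refine add_le_add ((hH i).trans ?_) ((hG i).trans ?_) <;> gcongr
        exacts [le_max_left _ _, le_max_right _ _]
    _ = _ := by ring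

theorem ExpBigO.mul (h : ExpBigO ε b k H)
    (h' : ExpBigO ε b l G) (hε : ∀ i, 0 ≤ ε i) (hb : ∀ i, 0 ≤ b i) :
    ExpBigO ε b (k + l) fun i => H i * G i := by
  obtain ⟨C, hC, hH⟩ := h
  obtain ⟨D, hD, hG⟩ := h'
  refine .of_le hε hb (mul_nonneg hC hD) (D := C + D) fun i => ?_
  have := hε i
  rw [abs_mul]
  calc |H i| * |G i| ≤ (C * ε i ^ k * Real.exp (C * b i)) * (D * ε i ^ l * Real.exp (D * b i)) := by
        gcongr
        exacts [hH i, hG i]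
    _ = _ := by rw [add_mul, Real.exp_add]; ring

theorem ExpBigO.mono (h : ExpBigO ε b k H) (hε : ∀ i, 0 ≤ ε i) (hε1 : ∀ i, ε i ≤ 1)
    (hl : l ≤ k) : ExpBigO ε b l H := by
  obtain ⟨C, hC, hH⟩ := h
  refine ⟨C, hC, fun i => (hH i).trans ?_⟩
  have := pow_le_pow_of_le_one (hε i) (hε1 i) hl
  gcongr

theorem ExpBigO.const_mul (hε : ∀ i, 0 ≤ ε i) (hb : ∀ i, 0 ≤ b i) (c : ℝ)
    (h : ExpBigO ε b k H) : ExpBigO ε b k fun i => c * H i := by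
  obtain ⟨C, hC, hH⟩ := h
  refine .of_le hε hb (C := |c| * C) (by positivity) (D := C) fun i => ?_
  rw [abs_mul, mul_assoc, mul_assoc, ← mul_assoc C]
  exact mul_le_mul_of_nonneg_left (hH i) (abs_nonneg c)

theorem ExpBigO.sub (hε : ∀ i, 0 ≤ ε i) (hb : ∀ i, 0 ≤ b i) (h : ExpBigO ε b k H)
    (h' : ExpBigO ε b k G) : ExpBigO ε b k fun i => H i - G i :=
  (h.add hε hb (h'.const_mul hε hb (-1))).congr fun i => by ring

theorem ExpBigO.sum (hε : ∀ i, 0 ≤ ε i) (hb : ∀ i, 0 ≤ b i) {J : Type*} (s : Finset J)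
    {F : J → ι → ℝ} (h : ∀ j, ExpBigO ε b k (F j)) : ExpBigO ε b k fun i => ∑ j ∈ s, F j i := by
  classical
  induction s using Finset.induction_on with
  | empty => exact ⟨0, le_rfl, fun i => by simp⟩
  | insert j s hj ih => exact ((h j).add hε hb ih).congr fun i => Finset.sum_insert hj

/-- Factoring the difference of squares gains one order, which allows a first-order quantity to be
replaced by its leading term inside a square. -/
theorem ExpBigO.sq_sub_sq (hε : ∀ i, 0 ≤ ε i) (hb : ∀ i, 0 ≤ b i) (hH : ExpBigO ε b 1 H)
    (hG : ExpBigO ε b 1 G) (h : ExpBigO ε b 2 fun i => H i - G i) :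
    ExpBigO ε b 3 fun i => H i ^ 2 - G i ^ 2 :=
  (h.mul (hH.add hε hb hG) hε hb).congr fun i => by ring

/-- The bound is uniform in the point of `K`, so it survives averaging and its constant does not
depend on `ν`. -/
theorem ExpBigO.integral {K : Type*} [MeasurableSpace K] {ν : ι → Measure K}
    [∀ i, IsProbabilityMeasure (ν i)] {F : ι → K → ℝ}
    (h : ExpBigO (fun q : ι × K => ε q.1) (fun q => b q.1) k fun q => F q.1 q.2) :
    ExpBigO ε b k fun i => ∫ x, F i x ∂ν i := by
  obtain ⟨C, hC, hF⟩ := h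
  refine ⟨C, hC, fun i => ?_⟩
  have := norm_integral_le_of_norm_le_const (μ := ν i) (f := F i)
    (C := C * ε i ^ k * Real.exp (C * b i)) (Filter.Eventually.of_forall fun x => hF (i, x))
  simpa using this

theorem AffineBigO.add (h : AffineBigO ε b H) (h' : AffineBigO ε b G) :
    AffineBigO ε b fun i => H i + G i := by
  obtain ⟨C, hC, hH⟩ := h
  obtain ⟨D, hD, hG⟩ := h'
  refine ⟨C + D, by positivity, fun i => ?_⟩
  linarith [abs_add_le (H i) (G i), hH i, hG i]

theorem AffineBigO.const_mul (c : ℝ) (h : AffineBigO ε b H) :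
    AffineBigO ε b fun i => c * H i := by
  obtain ⟨C, hC, hH⟩ := h
  refine ⟨|c| * C, by positivity, fun i => ?_⟩
  rw [abs_mul, mul_assoc, mul_assoc, ← mul_assoc C]
  exact mul_le_mul_of_nonneg_left (hH i) (abs_nonneg c)

theorem AffineBigO.sum {J : Type*} (s : Finset J) {F : J → ι → ℝ}
    (h : ∀ j, AffineBigO ε b (F j)) : AffineBigO ε b fun i => ∑ j ∈ s, F j i := by
  classical
  induction s using Finset.induction_on with
  | empty => exact ⟨0, le_rfl, fun i => by simp⟩
  | insert j s hj ih =>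
    have := (h j).add ih
    simpa only [Finset.sum_insert hj] using this

theorem AffineBigO.expBigO (hε : ∀ i, 0 ≤ ε i) (hb : ∀ i, 0 ≤ b i) (h : AffineBigO ε b H) :
    ExpBigO ε b 1 H := by
  obtain ⟨C, hC, hH⟩ := h
  refine .of_le hε hb hC (D := 1) fun i => (hH i).trans ?_
  have := hε i
  have := hb i
  rw [pow_one, one_mul, add_comm]
  gcongr
  exact Real.add_one_le_exp _

/-- The reason for tracking affine growth: its exponential is still exponential in `b`, hence
integrable against a Gaussian law when `b` is the norm. -/
theorem AffineBigO.exp_abs (hε : ∀ i, 0 ≤ ε i) (hε1 : ∀ i, ε i ≤ 1) (hb : ∀ i, 0 ≤ b i)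
    (h : AffineBigO ε b H) : ExpBigO ε b 0 fun i => Real.exp |H i| := by
  obtain ⟨C, hC, hH⟩ := h
  refine .of_le hε hb (Real.exp_pos C).le (D := C) fun i => ?_
  rw [Real.abs_exp, pow_zero, mul_one, ← Real.exp_add, Real.exp_le_exp]
  have h1 := hb i
  calc |H i| ≤ C * ε i * (1 + b i) := hH i
    _ ≤ C * 1 * (1 + b i) := by gcongr; exact hε1 i
    _ = _ := by ring

theorem abs_exp_sub_taylor_two_le (u : ℝ) :
    |Real.exp u - 1 - u - u ^ 2 / 2| ≤ |u| ^ 3 * Real.exp |u| := by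
  have h := Complex.norm_exp_sub_sum_le_norm_mul_exp (u : ℂ) 3
  simp only [Finset.sum_range_succ, Finset.sum_range_zero] at h
  norm_num at h
  rw [← Real.norm_eq_abs, ← Complex.norm_real]
  push_cast
  convert h using 2
  ring

/-- Second-order Taylor expansion of the exponential. -/
theorem AffineBigO.exp_taylor (hε : ∀ i, 0 ≤ ε i) (hε1 : ∀ i, ε i ≤ 1) (hb : ∀ i, 0 ≤ b i)
    (h : AffineBigO ε b H) :
    ExpBigO ε b 3 fun i => Real.exp (H i) - 1 - H i - H i ^ 2 / 2 := by
  have h1 := h.expBigO hε hb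
  obtain ⟨C, hC, hH⟩ := (((h1.mul h1 hε hb).mul h1 hε hb).mul (h.exp_abs hε hε1 hb) hε hb)
  refine ⟨C, hC, fun i => (abs_exp_sub_taylor_two_le (H i)).trans ?_⟩
  refine le_trans (le_of_eq ?_) (hH i)
  rw [abs_mul, abs_mul, abs_mul, Real.abs_exp]
  ring

end ExpBigO

/-! ### Pathwise second-order expansion of the product of masses -/

section OneStep

variable {ι K : Type*} [TopologicalSpace K] [CompactSpace K]
  {ε : ι → ℝ} {f : ι → C(K, ℝ)}

theorem affineBigO_exponent (hε : ∀ i, 0 ≤ ε i) (hε1 : ∀ i, ε i ≤ 1) (γ : ℝ) (v : C(K, ℝ)) :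
    AffineBigO (fun q : ι × K => ε q.1) (fun q => ‖f q.1‖)
      fun q => γ * (ε q.1 * f q.1 q.2) - γ ^ 2 / 2 * (ε q.1 ^ 2 * v q.2) := by
  refine ⟨|γ| + γ ^ 2 / 2 * ‖v‖, by positivity, fun q => ?_⟩
  have h1 : |f q.1 q.2| ≤ ‖f q.1‖ := (f q.1).norm_coe_le_norm q.2
  have h2 : |v q.2| ≤ ‖v‖ := v.norm_coe_le_norm q.2
  have h3 := hε q.1
  have h4 : ε q.1 ^ 2 ≤ ε q.1 := by nlinarith [hε1 q.1]
  have h5 := norm_nonneg (f q.1)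
  calc |γ * (ε q.1 * f q.1 q.2) - γ ^ 2 / 2 * (ε q.1 ^ 2 * v q.2)|
      ≤ |γ * (ε q.1 * f q.1 q.2)| + |γ ^ 2 / 2 * (ε q.1 ^ 2 * v q.2)| := abs_sub _ _
    _ = |γ| * (ε q.1 * |f q.1 q.2|) + γ ^ 2 / 2 * (ε q.1 ^ 2 * |v q.2|) := by
        simp only [abs_mul, abs_of_nonneg h3, abs_of_nonneg (sq_nonneg (ε q.1)),
          abs_of_nonneg (show 0 ≤ γ ^ 2 / 2 by positivity)]
    _ ≤ |γ| * (ε q.1 * (1 + ‖f q.1‖)) + γ ^ 2 / 2 * (ε q.1 * (‖v‖ * (1 + ‖f q.1‖))) := by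
        gcongr
        · linarith
        · nlinarith [norm_nonneg v]
    _ = _ := by ring

theorem expBigO_eval (hε : ∀ i, 0 ≤ ε i) :
    ExpBigO (fun q : ι × K => ε q.1) (fun q => ‖f q.1‖) 1 fun q => ε q.1 * f q.1 q.2 := by
  refine AffineBigO.expBigO (fun q => hε q.1) (fun q => norm_nonneg _)
    ⟨1, zero_le_one, fun q => ?_⟩
  have h1 : |f q.1 q.2| ≤ ‖f q.1‖ := (f q.1).norm_coe_le_norm q.2
  rw [abs_mul, abs_of_nonneg (hε q.1), one_mul]
  exact mul_le_mul_of_nonneg_left (by linarith) (hε q.1)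

variable [MeasurableSpace K] [BorelSpace K] {ν : ι → Measure K}

theorem integrable_of_continuous_of_compactSpace (μ : Measure K) [IsFiniteMeasure μ]
    {g : K → ℝ} (hg : Continuous g) : Integrable g μ := by
  rw [← integrableOn_univ]
  exact hg.continuousOn.integrableOn_compact' isCompact_univ MeasurableSet.univ

theorem integral_exp_pos' (μ : Measure K) [IsFiniteMeasure μ] [NeZero μ]
    {g : K → ℝ} (hg : Continuous g) : 0 < ∫ x, Real.exp (g x) ∂μ :=
  integral_exp_pos (integrable_of_continuous_of_compactSpace μ (by fun_prop))

/-- A probability average of exponentials lies between the exponentials of the extreme bounds. The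
two-sided control of the logarithm is what handles powers of either sign. -/
theorem affineBigO_log_integral [∀ i, IsProbabilityMeasure (ν i)]
    (hε : ∀ i, 0 ≤ ε i) (hε1 : ∀ i, ε i ≤ 1) (γ : ℝ) (v : C(K, ℝ)) :
    AffineBigO ε (fun i => ‖f i‖) fun i => Real.log
      (∫ x, Real.exp (γ * (ε i * f i x) - γ ^ 2 / 2 * (ε i ^ 2 * v x)) ∂ν i) := by
  obtain ⟨C, hC, h⟩ := affineBigO_exponent (f := f) hε hε1 γ v
  refine ⟨C, hC, fun i => ?_⟩
  set B := C * ε i * (1 + ‖f i‖)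
  have hint : Integrable (fun x => Real.exp (γ * (ε i * f i x) - γ ^ 2 / 2 * (ε i ^ 2 * v x)))
    (ν i) := integrable_of_continuous_of_compactSpace _ (by fun_prop)
  have hl : Real.exp (-B) ≤
      ∫ x, Real.exp (γ * (ε i * f i x) - γ ^ 2 / 2 * (ε i ^ 2 * v x)) ∂ν i := by
    have := integral_mono (μ := ν i) (integrable_const (Real.exp (-B))) hint fun x =>
      Real.exp_le_exp.2 (abs_le.1 (h (i, x))).1
    simpa using this
  have hu : ∫ x, Real.exp (γ * (ε i * f i x) - γ ^ 2 / 2 * (ε i ^ 2 * v x)) ∂ν i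
      ≤ Real.exp B := by
    have := integral_mono (μ := ν i) hint (integrable_const (Real.exp B)) fun x =>
      Real.exp_le_exp.2 (abs_le.1 (h (i, x))).2
    simpa using this
  have hpos := (Real.exp_pos _).trans_le hl
  exact abs_le.2 ⟨(Real.le_log_iff_exp_le hpos).2 hl, (Real.log_le_iff_le_exp hpos).2 hu⟩

omit [BorelSpace K] in
theorem expBigO_integral_eval [∀ i, IsProbabilityMeasure (ν i)] (hε : ∀ i, 0 ≤ ε i) :
    ExpBigO ε (fun i => ‖f i‖) 1 fun i => ε i * ∫ x, f i x ∂ν i :=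
  (ExpBigO.integral (ε := ε) (b := fun i => ‖f i‖) (F := fun i x => ε i * f i x)
    (expBigO_eval hε)).congr fun i => by rw [integral_const_mul]

omit [BorelSpace K] in
theorem expBigO_integral_sq_sub [∀ i, IsProbabilityMeasure (ν i)] (hε : ∀ i, 0 ≤ ε i)
    (v : C(K, ℝ)) :
    ExpBigO ε (fun i => ‖f i‖) 2 fun i => ε i ^ 2 * ∫ x, (f i x ^ 2 - v x) ∂ν i := by
  have hεK : ∀ q : ι × K, 0 ≤ ε q.1 := fun q => hε q.1
  have hbK : ∀ q : ι × K, 0 ≤ ‖f q.1‖ := fun q => norm_nonneg _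
  have hf := expBigO_eval (K := K) (f := f) hε
  have hv : ExpBigO (fun q : ι × K => ε q.1) (fun q => ‖f q.1‖) 2 fun q => ε q.1 ^ 2 * v q.2 := by
    refine .of_le hεK hbK (C := ‖v‖) (by positivity) (D := 0) fun q => ?_
    have h2 : |v q.2| ≤ ‖v‖ := v.norm_coe_le_norm q.2
    rw [abs_mul, abs_of_nonneg (sq_nonneg (ε q.1)), zero_mul, Real.exp_zero, mul_one, mul_comm]
    gcongr
  have := ExpBigO.integral (ε := ε) (b := fun i => ‖f i‖) (k := 2) (ν := ν)
    (F := fun i x => ε i ^ 2 * (f i x ^ 2 - v x)) (by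
      refine ((hf.mul hf hεK hbK).sub hεK hbK hv).congr fun q => ?_
      ring)
  exact this.congr fun i => by rw [integral_const_mul]

/-- Second-order expansion of the logarithm of the mass. -/
theorem expBigO_log_integral_sub [∀ i, IsProbabilityMeasure (ν i)]
    (hε : ∀ i, 0 ≤ ε i) (hε1 : ∀ i, ε i ≤ 1) (γ : ℝ) (v : C(K, ℝ)) :
    ExpBigO ε (fun i => ‖f i‖) 3 fun i =>
      Real.log (∫ x, Real.exp (γ * (ε i * f i x) - γ ^ 2 / 2 * (ε i ^ 2 * v x)) ∂ν i)
      - (ε i * (γ * ∫ x, f i x ∂ν i) + ε i ^ 2 * (γ ^ 2 / 2 * ∫ x, (f i x ^ 2 - v x) ∂ν i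
        - γ ^ 2 / 2 * (∫ x, f i x ∂ν i) ^ 2)) := by
  have hεK : ∀ q : ι × K, 0 ≤ ε q.1 := fun q => hε q.1
  have hε1K : ∀ q : ι × K, ε q.1 ≤ 1 := fun q => hε1 q.1
  have hbK : ∀ q : ι × K, 0 ≤ ‖f q.1‖ := fun q => norm_nonneg _
  have hb : ∀ i, 0 ≤ ‖f i‖ := fun i => norm_nonneg _
  have hg := affineBigO_exponent (f := f) hε hε1 γ v
  have hf := (expBigO_eval (K := K) (f := f) hε).const_mul hεK hbK γ
  have hv : ExpBigO (fun q : ι × K => ε q.1) (fun q => ‖f q.1‖) 2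
      fun q => (γ * (ε q.1 * f q.1 q.2) - γ ^ 2 / 2 * (ε q.1 ^ 2 * v q.2))
        - γ * (ε q.1 * f q.1 q.2) := by
    refine .of_le hεK hbK (C := γ ^ 2 / 2 * ‖v‖) (by positivity) (D := 0) fun q => ?_
    have h2 : |v q.2| ≤ ‖v‖ := v.norm_coe_le_norm q.2
    rw [sub_right_comm, sub_self, zero_sub, abs_neg, abs_mul, abs_mul,
      abs_of_nonneg (sq_nonneg (ε q.1)), abs_of_nonneg (show 0 ≤ γ ^ 2 / 2 by positivity)]
    rw [zero_mul, Real.exp_zero, mul_one, mul_comm (ε q.1 ^ 2), ← mul_assoc]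
    gcongr
  -- The `v` term of the exponent is already of order `ε²`, so the squared exponent equals the
  -- square of its linear part up to `ε³`.
  have hE := (hg.exp_taylor hεK hε1K hbK).add hεK hbK
    (((hg.expBigO hεK hbK).sq_sub_sq hεK hbK hf hv).const_mul hεK hbK (1 / 2))
  have hI : ExpBigO ε (fun i => ‖f i‖) 3 fun i =>
      (∫ x, Real.exp (γ * (ε i * f i x) - γ ^ 2 / 2 * (ε i ^ 2 * v x)) ∂ν i) - 1
      - (ε i * (γ * ∫ x, f i x ∂ν i) + ε i ^ 2 * (γ ^ 2 / 2 * ∫ x, (f i x ^ 2 - v x) ∂ν i)) := by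
    have := ExpBigO.integral (ε := ε) (b := fun i => ‖f i‖) (k := 3) (ν := ν) (F := fun i x =>
      Real.exp (γ * (ε i * f i x) - γ ^ 2 / 2 * (ε i ^ 2 * v x)) - 1
      - (ε i * (γ * f i x) + ε i ^ 2 * (γ ^ 2 / 2 * (f i x ^ 2 - v x)))) (by
        refine hE.congr fun q => ?_
        ring)
    refine this.congr fun i => ?_
    have hc : ∀ g : K → ℝ, Continuous g → Integrable g (ν i) := fun g =>
      integrable_of_continuous_of_compactSpace (ν i)
    symm
    refine (integral_sub (hc _ (by fun_prop)) (hc _ (by fun_prop))).trans ?_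
    congr 1
    · exact (integral_sub (hc _ (by fun_prop)) (hc _ (by fun_prop))).trans (by simp)
    · refine (integral_add (hc _ (by fun_prop)) (hc _ (by fun_prop))).trans ?_
      simp only [integral_const_mul]
  have hm := (expBigO_integral_eval (f := f) (ν := ν) hε).const_mul hε hb γ
  have hq := (expBigO_integral_sq_sub (f := f) (ν := ν) hε v).const_mul hε hb (γ ^ 2 / 2)
  have hℓ := affineBigO_log_integral (f := f) (ν := ν) hε hε1 γ v
  have hℓ1 := hℓ.expBigO hε hb
  have hR := hℓ.exp_taylor hε hε1 hb
  -- The logarithm `ℓ` of the mass is not expanded directly: the Taylor formula for `exp ℓ` gives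
  -- mass `= 1 + ℓ + ℓ²/2 + O(ε³)`, which is solved for `ℓ`.
  have hS : ∀ i, Real.exp (Real.log
      (∫ x, Real.exp (γ * (ε i * f i x) - γ ^ 2 / 2 * (ε i ^ 2 * v x)) ∂ν i))
      = ∫ x, Real.exp (γ * (ε i * f i x) - γ ^ 2 / 2 * (ε i ^ 2 * v x)) ∂ν i := fun i =>
    Real.exp_log (integral_exp_pos' _ (by fun_prop))
  simp only [hS] at hR
  -- Bootstrap: `ℓ` agrees with its linear term up to `ε²`, hence `ℓ²` agrees with the square of
  -- that term up to `ε³`.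
  have h2 := ((hI.sub hε hb hR).mono (l := 2) hε hε1 (by norm_num)).add hε hb
    ((hq.congr fun i => mul_left_comm _ _ _).sub hε hb ((hℓ1.mul hℓ1 hε hb).const_mul hε hb (1 / 2)))
  have h3 := hℓ1.sq_sub_sq hε hb (hm.congr fun i => mul_left_comm _ _ _) (h2.congr fun i => by ring)
  exact ((hI.sub hε hb hR).sub hε hb (h3.const_mul hε hb (1 / 2))).congr fun i => by ring

/-- The product `∏ j, (∫ exp (γ_j f(x) - (γ_j² / 2) v(x)) ν_j(dx)) ^ p_j`. -/
noncomputable def massProd {n : ℕ} (p γ : Fin n → ℝ) (ν : Fin n → Measure K) (v f : C(K, ℝ)) : ℝ :=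
  ∏ j, (∫ x, Real.exp (γ j * f x - γ j ^ 2 / 2 * v x) ∂ν j) ^ p j

theorem massProd_eq_exp {n : ℕ} (p γ : Fin n → ℝ) (ν : Fin n → Measure K)
    [∀ j, IsProbabilityMeasure (ν j)] (v f : C(K, ℝ)) :
    massProd p γ ν v f =
      Real.exp (∑ j, p j * Real.log (∫ x, Real.exp (γ j * f x - γ j ^ 2 / 2 * v x) ∂ν j)) := by
  rw [massProd, Real.exp_sum]
  refine Finset.prod_congr rfl fun j _ => ?_
  rw [Real.rpow_def_of_pos (integral_exp_pos' _ (by fun_prop)), mul_comm]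

variable {n : ℕ} (p γ : Fin n → ℝ) {ρ : Fin n → ι → Measure K}
  [∀ j i, IsProbabilityMeasure (ρ j i)] (v : C(K, ℝ))

theorem affineBigO_sum_log (hε : ∀ i, 0 ≤ ε i) (hε1 : ∀ i, ε i ≤ 1) :
    AffineBigO ε (fun i => ‖f i‖) fun i => ∑ j, p j * Real.log
      (∫ x, Real.exp (γ j * (ε i * f i x) - γ j ^ 2 / 2 * (ε i ^ 2 * v x)) ∂ρ j i) :=
  .sum _ fun j => (affineBigO_log_integral hε hε1 (γ j) v).const_mul (p j)

theorem expBigO_massProd (hε : ∀ i, 0 ≤ ε i) (hε1 : ∀ i, ε i ≤ 1) :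
    ExpBigO ε (fun i => ‖f i‖) 0 fun i =>
      massProd p γ (fun j => ρ j i) (ε i ^ 2 • v) (ε i • f i) := by
  obtain ⟨C, hC, h⟩ := (affineBigO_sum_log (f := f) (ρ := ρ) p γ v hε hε1).exp_abs hε hε1
    fun i => norm_nonneg (f i)
  refine ⟨C, hC, fun i => le_trans ?_ (h i)⟩
  simp only [massProd_eq_exp, Real.abs_exp, ContinuousMap.smul_apply, smul_eq_mul]
  exact Real.exp_le_exp.2 (le_abs_self _)

/-- Used to keep the small-scale expectation above `1/2`, so that additive errors become
multiplicative ones. -/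
theorem expBigO_massProd_sub_one (hε : ∀ i, 0 ≤ ε i) (hε1 : ∀ i, ε i ≤ 1) :
    ExpBigO ε (fun i => ‖f i‖) 1 fun i =>
      massProd p γ (fun j => ρ j i) (ε i ^ 2 • v) (ε i • f i) - 1 := by
  have hb : ∀ i, 0 ≤ ‖f i‖ := fun i => norm_nonneg _
  have hT := affineBigO_sum_log (f := f) (ρ := ρ) p γ v hε hε1
  have hT1 := hT.expBigO hε hb
  refine ((((hT.exp_taylor hε hε1 hb).mono hε hε1 (by norm_num)).add hε hb hT1).add hε hb
    (((hT1.mul hT1 hε hb).mono (l := 1) hε hε1 (by norm_num)).const_mul hε hb (1 / 2))).congr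
      fun i => ?_
  simp only [massProd_eq_exp, ContinuousMap.smul_apply, smul_eq_mul]
  ring

/-- Second-order expansion of the product of masses. -/
theorem expBigO_massProd_sub (hε : ∀ i, 0 ≤ ε i) (hε1 : ∀ i, ε i ≤ 1) :
    ExpBigO ε (fun i => ‖f i‖) 3 fun i =>
      massProd p γ (fun j => ρ j i) (ε i ^ 2 • v) (ε i • f i)
      - (1 + ε i * ∑ j, p j * (γ j * ∫ x, f i x ∂ρ j i)
        + ε i ^ 2 * (∑ j, p j * (γ j ^ 2 / 2 * ∫ x, (f i x ^ 2 - v x) ∂ρ j i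
            - γ j ^ 2 / 2 * (∫ x, f i x ∂ρ j i) ^ 2)
          + (∑ j, p j * (γ j * ∫ x, f i x ∂ρ j i)) ^ 2 / 2)) := by
  have hb : ∀ i, 0 ≤ ‖f i‖ := fun i => norm_nonneg _
  have hT := affineBigO_sum_log (f := f) (ρ := ρ) p γ v hε hε1
  have hT1 := hT.expBigO hε hb
  have hTs : ExpBigO ε (fun i => ‖f i‖) 3 fun i => (∑ j, p j * Real.log
      (∫ x, Real.exp (γ j * (ε i * f i x) - γ j ^ 2 / 2 * (ε i ^ 2 * v x)) ∂ρ j i))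
      - (ε i * ∑ j, p j * (γ j * ∫ x, f i x ∂ρ j i)
        + ε i ^ 2 * ∑ j, p j * (γ j ^ 2 / 2 * ∫ x, (f i x ^ 2 - v x) ∂ρ j i
            - γ j ^ 2 / 2 * (∫ x, f i x ∂ρ j i) ^ 2)) := by
    refine (ExpBigO.sum hε hb Finset.univ fun j => (expBigO_log_integral_sub (f := f)
      (ν := ρ j) hε hε1 (γ j) v).const_mul hε hb (p j)).congr fun i => ?_
    rw [Finset.mul_sum, Finset.mul_sum, ← Finset.sum_add_distrib, ← Finset.sum_sub_distrib]
    exact Finset.sum_congr rfl fun j _ => by ring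
  have hM : ExpBigO ε (fun i => ‖f i‖) 1 fun i =>
      ε i * ∑ j, p j * (γ j * ∫ x, f i x ∂ρ j i) := by
    refine (ExpBigO.sum hε hb Finset.univ fun j => (expBigO_integral_eval (f := f)
      (ν := ρ j) hε).const_mul hε hb (p j * γ j)).congr fun i => ?_
    rw [Finset.mul_sum]
    exact Finset.sum_congr rfl fun j _ => by ring
  have hN : ExpBigO ε (fun i => ‖f i‖) 2 fun i =>
      ε i ^ 2 * ∑ j, p j * (γ j ^ 2 / 2 * ∫ x, (f i x ^ 2 - v x) ∂ρ j i
            - γ j ^ 2 / 2 * (∫ x, f i x ∂ρ j i) ^ 2) := by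
    refine (ExpBigO.sum hε hb Finset.univ fun j => ((expBigO_integral_sq_sub (f := f)
      (ν := ρ j) hε v).sub hε hb (((expBigO_integral_eval (f := f) (ν := ρ j) hε).mul
        (expBigO_integral_eval (f := f) (ν := ρ j) hε) hε hb))).const_mul hε hb
          (p j * (γ j ^ 2 / 2))).congr fun i => ?_
    rw [Finset.mul_sum]
    exact Finset.sum_congr rfl fun j _ => by ring
  have hsq := hT1.sq_sub_sq hε hb hM
    (((hTs.mono hε hε1 (by norm_num)).add hε hb hN).congr fun i => by ring)
  refine (((hT.exp_taylor hε hε1 hb).add hε hb hTs).add hε hb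
    (hsq.const_mul hε hb (1 / 2))).congr fun i => ?_
  simp only [massProd_eq_exp, ContinuousMap.smul_apply, smul_eq_mul]
  ring

end OneStep

/-! ### Expectation of the expansion and one-step comparison -/

section Expectation

variable {K : Type*} [MetricSpace K] [CompactSpace K] [MeasurableSpace K] [BorelSpace K]
  [MeasurableSpace C(K, ℝ)] [BorelSpace C(K, ℝ)]

theorem measurable_massProd {n : ℕ} (p γ : Fin n → ℝ) (ν : Fin n → Measure K)
    [∀ j, IsFiniteMeasure (ν j)] (v : C(K, ℝ)) : Measurable (massProd p γ ν v) := by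
  refine Finset.measurable_fun_prod _ fun j _ => Measurable.pow_const ?_ _
  have h : StronglyMeasurable fun q : C(K, ℝ) × K =>
      Real.exp (γ j * q.1 q.2 - γ j ^ 2 / 2 * v q.2) := by
    refine Continuous.stronglyMeasurable ?_
    fun_prop
  exact h.integral_prod_right.measurable

variable (μ : Measure C(K, ℝ)) [IsGaussian μ]

omit [MeasurableSpace K] [BorelSpace K] in
theorem integrable_prod_of_le_exp_norm {Z : Type*} [TopologicalSpace Z]
    [SecondCountableTopology Z] [MeasurableSpace Z] [BorelSpace Z] (ρ : Measure Z)
    [IsFiniteMeasure ρ] {F : C(K, ℝ) → Z → ℝ} (hF : Continuous (Function.uncurry F)) {B c : ℝ}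
    (h : ∀ f z, |F f z| ≤ B * Real.exp (c * ‖f‖)) :
    Integrable (Function.uncurry F) (μ.prod ρ) := by
  refine (((integrable_exp_mul_norm_of_isGaussian μ c).const_mul B).comp_fst ρ).mono'
    hF.aestronglyMeasurable ?_
  filter_upwards with q using h q.1 q.2

omit [MeasurableSpace K] [BorelSpace K] [MeasurableSpace C(K, ℝ)] [BorelSpace C(K, ℝ)] in
theorem abs_eval_le_exp (f : C(K, ℝ)) (x : K) : |f x| ≤ Real.exp (1 * ‖f‖) := by
  have h1 : |f x| ≤ ‖f‖ := f.norm_coe_le_norm x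
  rw [one_mul]
  linarith [Real.add_one_le_exp ‖f‖]

omit [MeasurableSpace K] [BorelSpace K] [MeasurableSpace C(K, ℝ)] [BorelSpace C(K, ℝ)] in
theorem abs_eval_mul_eval_le_exp (f : C(K, ℝ)) (x y : K) :
    |f x * f y| ≤ 1 * Real.exp (2 * ‖f‖) := by
  rw [abs_mul, one_mul, two_mul, Real.exp_add]
  have hx := abs_eval_le_exp f x
  have hy := abs_eval_le_exp f y
  rw [one_mul] at hx hy
  gcongr

omit [MeasurableSpace K] [BorelSpace K] in
theorem integrable_eval_mul_eval (x y : K) : Integrable (fun f : C(K, ℝ) => f x * f y) μ := by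
  refine ((integrable_exp_mul_norm_of_isGaussian μ 2).const_mul 1).mono' (by fun_prop) ?_
  filter_upwards with f using abs_eval_mul_eval_le_exp f x y

omit [MeasurableSpace K] [BorelSpace K] in
theorem continuous_integral_eval_sq : Continuous fun x : K => ∫ f, f x ^ 2 ∂μ := by
  refine continuous_of_dominated (bound := fun f => 1 * Real.exp (2 * ‖f‖)) (fun x => ?_)
    (fun x => ?_) ((integrable_exp_mul_norm_of_isGaussian μ 2).const_mul 1) ?_
  · simpa only [sq] using (integrable_eval_mul_eval μ x x).aestronglyMeasurable
  · filter_upwards with f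
    rw [Real.norm_eq_abs, sq]
    exact abs_eval_mul_eval_le_exp f x x
  · filter_upwards with f
    fun_prop

theorem integrable_integral_eval (ν : Measure K) [IsFiniteMeasure ν] :
    Integrable (fun f : C(K, ℝ) => ∫ x, f x ∂ν) μ :=
  (integrable_prod_of_le_exp_norm μ ν (F := fun f x => f x) (by fun_prop) (B := 1) (c := 1)
    fun f x => by rw [one_mul]; exact abs_eval_le_exp f x).integral_prod_left

theorem integral_integral_eval (h0 : ∀ x, ∫ f, f x ∂μ = 0) (ν : Measure K) [IsFiniteMeasure ν] :
    ∫ f : C(K, ℝ), ∫ x, f x ∂ν ∂μ = 0 := by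
  rw [integral_integral_swap (integrable_prod_of_le_exp_norm μ ν (F := fun f x => f x)
    (by fun_prop) (B := 1) (c := 1) fun f x => by rw [one_mul]; exact abs_eval_le_exp f x)]
  simp [h0]

theorem integrable_uncurry_sq_sub (v : C(K, ℝ)) (ν : Measure K) [IsFiniteMeasure ν] :
    Integrable (Function.uncurry fun (f : C(K, ℝ)) (x : K) => f x ^ 2 - v x) (μ.prod ν) := by
  refine integrable_prod_of_le_exp_norm μ ν (by fun_prop) (B := 1 + ‖v‖) (c := 2) fun f x => ?_
  have h1 := abs_eval_mul_eval_le_exp f x x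
  have h2 : |v x| ≤ ‖v‖ := v.norm_coe_le_norm x
  have h3 : 1 ≤ Real.exp (2 * ‖f‖) := Real.one_le_exp (by positivity)
  calc |f x ^ 2 - v x| ≤ |f x ^ 2| + |v x| := abs_sub _ _
    _ ≤ 1 * Real.exp (2 * ‖f‖) + ‖v‖ * Real.exp (2 * ‖f‖) := by
        rw [sq]
        refine add_le_add h1 (h2.trans ?_)
        exact le_mul_of_one_le_right (norm_nonneg v) h3
    _ = _ := by ring

/-- Here the normalization matters: `v` is exactly the variance, so `f x ^ 2 - v x` is centered. -/
theorem integral_integral_sq_sub (v : C(K, ℝ)) (hv : ∀ x, v x = ∫ f, f x ^ 2 ∂μ) (ν : Measure K)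
    [IsFiniteMeasure ν] : ∫ f : C(K, ℝ), ∫ x, (f x ^ 2 - v x) ∂ν ∂μ = 0 := by
  rw [integral_integral_swap (integrable_uncurry_sq_sub μ v ν)]
  refine integral_eq_zero_of_ae (Filter.Eventually.of_forall fun x => ?_)
  simp only [Pi.zero_apply]
  rw [integral_sub _ (integrable_const _), ← hv x]
  · simp
  · simpa only [sq] using integrable_eval_mul_eval μ x x

theorem integrable_uncurry_eval_mul_eval (ν ν' : Measure K) [IsFiniteMeasure ν]
    [IsFiniteMeasure ν'] :
    Integrable (Function.uncurry fun (f : C(K, ℝ)) (z : K × K) => f z.1 * f z.2)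
      (μ.prod (ν.prod ν')) :=
  integrable_prod_of_le_exp_norm μ (ν.prod ν') (by fun_prop) (B := 1) (c := 2) fun f z =>
    abs_eval_mul_eval_le_exp f z.1 z.2

theorem integrable_integral_mul_integral (ν ν' : Measure K) [IsFiniteMeasure ν]
    [IsFiniteMeasure ν'] :
    Integrable (fun f : C(K, ℝ) => (∫ x, f x ∂ν) * ∫ x, f x ∂ν') μ := by
  simp_rw [← integral_prod_mul]
  exact (integrable_uncurry_eval_mul_eval μ ν ν').integral_prod_left

theorem integral_integral_mul_integral (ν ν' : Measure K) [IsFiniteMeasure ν]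
    [IsFiniteMeasure ν'] :
    ∫ f : C(K, ℝ), (∫ x, f x ∂ν) * ∫ x, f x ∂ν' ∂μ =
      ∫ z, (∫ f : C(K, ℝ), f z.1 * f z.2 ∂μ) ∂(ν.prod ν') := by
  simp_rw [← integral_prod_mul]
  exact integral_integral_swap (integrable_uncurry_eval_mul_eval μ ν ν')

theorem integrable_integral_eval_mul_eval (ν ν' : Measure K) [IsFiniteMeasure ν]
    [IsFiniteMeasure ν'] :
    Integrable (fun z : K × K => ∫ f : C(K, ℝ), f z.1 * f z.2 ∂μ) (ν.prod ν') :=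
  (integrable_uncurry_eval_mul_eval μ ν ν').integral_prod_right

/-- By Fubini each expectation is an average of the covariance over `ν.prod ν'`. -/
theorem abs_integral_mul_sub_le (μ' : Measure C(K, ℝ)) [IsGaussian μ'] {A : ℝ}
    (hA : ∀ x y, |(∫ f, f x * f y ∂μ) - ∫ f, f x * f y ∂μ'| ≤ A) (ν ν' : Measure K)
    [IsProbabilityMeasure ν] [IsProbabilityMeasure ν'] :
    |(∫ f : C(K, ℝ), (∫ x, f x ∂ν) * ∫ x, f x ∂ν' ∂μ)
      - ∫ f : C(K, ℝ), (∫ x, f x ∂ν) * ∫ x, f x ∂ν' ∂μ'| ≤ A := by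
  rw [integral_integral_mul_integral, integral_integral_mul_integral, ← integral_sub
    (integrable_integral_eval_mul_eval μ ν ν') (integrable_integral_eval_mul_eval μ' ν ν')]
  have := norm_integral_le_of_norm_le_const (μ := ν.prod ν')
    (f := fun z => (∫ f, f z.1 * f z.2 ∂μ) - ∫ f, f z.1 * f z.2 ∂μ') (C := A)
    (Filter.Eventually.of_forall fun z => hA z.1 z.2)
  simpa using this

variable {n : ℕ} (p γ : Fin n → ℝ)

/-- The second-order coefficient in the small-scale expansion of the expected product of masses. -/
noncomputable def massProdCoeff (ν : Fin n → Measure K) : ℝ :=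
  ((∑ i, ∑ j, (p i * γ i * (p j * γ j)) *
      ∫ f : C(K, ℝ), (∫ x, f x ∂ν i) * ∫ x, f x ∂ν j ∂μ)
    - ∑ j, p j * γ j ^ 2 * ∫ f : C(K, ℝ), (∫ x, f x ∂ν j) * ∫ x, f x ∂ν j ∂μ) / 2

theorem massProdCoeff_sub_le (μ' : Measure C(K, ℝ)) [IsGaussian μ'] {A : ℝ}
    (hA : ∀ x y, |(∫ f, f x * f y ∂μ) - ∫ f, f x * f y ∂μ'| ≤ A) (ν : Fin n → Measure K)
    [∀ j, IsProbabilityMeasure (ν j)] :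
    massProdCoeff μ p γ ν - massProdCoeff μ' p γ ν ≤
      ((∑ i, ∑ j, |p i * γ i * (p j * γ j)| * A) + ∑ j, |p j * γ j ^ 2| * A) / 2 := by
  have h := fun i j => abs_integral_mul_sub_le μ μ' hA (ν i) (ν j)
  have hc : ∀ (c : ℝ) i j, |c * (∫ f : C(K, ℝ), (∫ x, f x ∂ν i) * ∫ x, f x ∂ν j ∂μ)
      - c * ∫ f : C(K, ℝ), (∫ x, f x ∂ν i) * ∫ x, f x ∂ν j ∂μ'| ≤ |c| * A := by
    intro c i j
    rw [← mul_sub, abs_mul]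
    exact mul_le_mul_of_nonneg_left (h i j) (abs_nonneg c)
  have h1 := Finset.sum_le_sum fun i (_ : i ∈ Finset.univ) => Finset.sum_le_sum
    fun j (_ : j ∈ Finset.univ) => (abs_le.1 (hc (p i * γ i * (p j * γ j)) i j)).2
  have h2 := Finset.sum_le_sum fun j (_ : j ∈ Finset.univ) =>
    (abs_le.1 (hc (p j * γ j ^ 2) j j)).1
  simp only [Finset.sum_sub_distrib, Finset.sum_neg_distrib] at h1 h2
  simp only [massProdCoeff]
  linarith

omit [MeasurableSpace K] [BorelSpace K] in
-- Exponential moments of the norm are finite. The parameter `j` later carries the measures, and `D`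
-- does not depend on it.
theorem ExpBigO.exists_integral_le {J : Type*} {k : ℕ}
    {F : Set.Ioc (0 : ℝ) 1 × C(K, ℝ) × J → ℝ}
    (h : ExpBigO (fun i => (i.1 : ℝ)) (fun i => ‖i.2.1‖) k F)
    (hF : ∀ ε j, AEStronglyMeasurable (fun f => F (ε, f, j)) μ) :
    ∃ D, 0 ≤ D ∧ ∀ ε j, Integrable (fun f => F (ε, f, j)) μ ∧
      |∫ f, F (ε, f, j) ∂μ| ≤ D * (ε : ℝ) ^ k := by
  obtain ⟨C, hC, h⟩ := h
  refine ⟨C * ∫ f, Real.exp (C * ‖f‖) ∂μ,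
    mul_nonneg hC (integral_nonneg fun f => (Real.exp_pos _).le), fun ε j => ?_⟩
  have hb : Integrable (fun f : C(K, ℝ) => C * (ε : ℝ) ^ k * Real.exp (C * ‖f‖)) μ :=
    (integrable_exp_mul_norm_of_isGaussian μ C).const_mul _
  have hle : ∀ f, ‖F (ε, f, j)‖ ≤ C * (ε : ℝ) ^ k * Real.exp (C * ‖f‖) := fun f => h (ε, f, j)
  refine ⟨hb.mono' (hF ε j) (Filter.Eventually.of_forall hle), ?_⟩
  refine (norm_integral_le_of_norm_le hb (Filter.Eventually.of_forall hle)).trans_eq ?_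
  rw [integral_const_mul]
  ring

/-- The linear and centered-square terms have mean zero; only the products of two averages of `f`
contribute. -/
theorem integral_secondOrder_massProd (h0 : ∀ x, ∫ f, f x ∂μ = 0) (v : C(K, ℝ))
    (hv : ∀ x, v x = ∫ f, f x ^ 2 ∂μ) (ε : ℝ) (ν : Fin n → Measure K)
    [∀ j, IsFiniteMeasure (ν j)] :
    Integrable (fun f : C(K, ℝ) => 1 + ε * ∑ j, p j * (γ j * ∫ x, f x ∂ν j)
        + ε ^ 2 * (∑ j, p j * (γ j ^ 2 / 2 * ∫ x, (f x ^ 2 - v x) ∂ν j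
            - γ j ^ 2 / 2 * (∫ x, f x ∂ν j) ^ 2)
          + (∑ j, p j * (γ j * ∫ x, f x ∂ν j)) ^ 2 / 2)) μ ∧
      ∫ f : C(K, ℝ), (1 + ε * ∑ j, p j * (γ j * ∫ x, f x ∂ν j)
        + ε ^ 2 * (∑ j, p j * (γ j ^ 2 / 2 * ∫ x, (f x ^ 2 - v x) ∂ν j
            - γ j ^ 2 / 2 * (∫ x, f x ∂ν j) ^ 2)
          + (∑ j, p j * (γ j * ∫ x, f x ∂ν j)) ^ 2 / 2)) ∂μ
        = 1 + ε ^ 2 * massProdCoeff μ p γ ν := by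
  let HI : (C(K, ℝ) → ℝ) → ℝ → Prop := fun F c => Integrable F μ ∧ ∫ f, F f ∂μ = c
  have add : ∀ {F G a b}, HI F a → HI G b → HI (fun f => F f + G f) (a + b) := fun hF hG =>
    ⟨hF.1.add hG.1, (integral_add hF.1 hG.1).trans (by rw [hF.2, hG.2])⟩
  have sub : ∀ {F G a b}, HI F a → HI G b → HI (fun f => F f - G f) (a - b) := fun hF hG =>
    ⟨hF.1.sub hG.1, (integral_sub hF.1 hG.1).trans (by rw [hF.2, hG.2])⟩
  have cmul : ∀ {F a} (c : ℝ), HI F a → HI (fun f => c * F f) (c * a) := fun c hF =>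
    ⟨hF.1.const_mul c, (integral_const_mul c _).trans (by rw [hF.2])⟩
  have sum : ∀ {F : Fin n → C(K, ℝ) → ℝ} {a : Fin n → ℝ}, (∀ j, HI (F j) (a j)) →
      HI (fun f => ∑ j, F j f) (∑ j, a j) := fun hF =>
    ⟨integrable_finsetSum _ fun j _ => (hF j).1, (integral_finsetSum _ fun j _ => (hF j).1).trans
      (Finset.sum_congr rfl fun j _ => (hF j).2)⟩
  have hm : ∀ j, HI (fun f => ∫ x, f x ∂ν j) 0 := fun j =>
    ⟨integrable_integral_eval μ (ν j), integral_integral_eval μ h0 (ν j)⟩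
  have hs : ∀ j, HI (fun f => ∫ x, (f x ^ 2 - v x) ∂ν j) 0 := fun j =>
    ⟨(integrable_uncurry_sq_sub μ v (ν j)).integral_prod_left, integral_integral_sq_sub μ v hv (ν j)⟩
  have hc : ∀ i j, HI (fun f => (∫ x, f x ∂ν i) * ∫ x, f x ∂ν j)
      (∫ f : C(K, ℝ), (∫ x, f x ∂ν i) * ∫ x, f x ∂ν j ∂μ) := fun i j =>
    ⟨integrable_integral_mul_integral μ (ν i) (ν j), rfl⟩
  have h1 : HI (fun _ => 1) 1 := ⟨integrable_const 1, by simp⟩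
  have hsq : ∀ f : C(K, ℝ), (∑ j, p j * (γ j * ∫ x, f x ∂ν j)) ^ 2 / 2 =
      1 / 2 * ∑ i, ∑ j, (p i * γ i * (p j * γ j)) * ((∫ x, f x ∂ν i) * ∫ x, f x ∂ν j) := by
    intro f
    rw [sq, Finset.sum_mul_sum, div_eq_inv_mul, one_div]
    exact congrArg _ (Finset.sum_congr rfl fun i _ => Finset.sum_congr rfl fun j _ => by ring)
  simp only [hsq, sq (∫ _, _ ∂_)]
  have key := add (add h1 (cmul ε (sum fun j => cmul (p j) (cmul (γ j) (hm j)))))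
    (cmul (ε ^ 2) (add (sum fun j => cmul (p j) (sub (cmul (γ j ^ 2 / 2) (hs j))
      (cmul (γ j ^ 2 / 2) (hc j j)))) (cmul (1 / 2) (sum fun i => sum fun j =>
        cmul (p i * γ i * (p j * γ j)) (hc i j)))))
  refine ⟨key.1, key.2.trans ?_⟩
  have hd : ∑ j, p j * (γ j ^ 2 / 2 * 0 - γ j ^ 2 / 2 *
      ∫ f : C(K, ℝ), (∫ x, f x ∂ν j) * ∫ x, f x ∂ν j ∂μ) = - (1 / 2) *
      ∑ j, p j * γ j ^ 2 * ∫ f : C(K, ℝ), (∫ x, f x ∂ν j) * ∫ x, f x ∂ν j ∂μ := by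
    rw [Finset.mul_sum]
    exact Finset.sum_congr rfl fun j _ => by ring
  rw [hd, massProdCoeff]
  simp only [mul_zero, Finset.sum_const_zero]
  ring

/-- Small-scale expansion of the expected product of masses, uniformly in the measures. -/
theorem exists_abs_integral_massProd_sub_le (h0 : ∀ x, ∫ f, f x ∂μ = 0) (v : C(K, ℝ))
    (hv : ∀ x, v x = ∫ f, f x ^ 2 ∂μ) :
    ∃ D, 0 ≤ D ∧ ∀ ε : ℝ, 0 < ε → ε ≤ 1 → ∀ (ν : Fin n → Measure K)
      [∀ j, IsProbabilityMeasure (ν j)],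
      Integrable (fun f => massProd p γ ν (ε ^ 2 • v) (ε • f)) μ ∧
      |(∫ f, massProd p γ ν (ε ^ 2 • v) (ε • f) ∂μ) - 1| ≤ D * ε ∧
      |(∫ f, massProd p γ ν (ε ^ 2 • v) (ε • f) ∂μ) - (1 + ε ^ 2 * massProdCoeff μ p γ ν)|
        ≤ D * ε ^ 3 := by
  -- The measures belong to the index, which makes the constants uniform over them. This is
  -- essential, as the tilted measures depend on the frozen path.
  let ι := Set.Ioc (0 : ℝ) 1 × C(K, ℝ) × (Fin n → ProbabilityMeasure K)
  have hε : ∀ i : ι, (0 : ℝ) ≤ i.1 := fun i => i.1.2.1.le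
  have hε1 : ∀ i : ι, (i.1 : ℝ) ≤ 1 := fun i => i.1.2.2
  have hmeas : ∀ (ε : ℝ) (ν : Fin n → ProbabilityMeasure K), AEStronglyMeasurable
      (fun f => massProd p γ (fun j => (ν j : Measure K)) (ε ^ 2 • v) (ε • f)) μ := fun ε ν =>
    ((measurable_massProd p γ _ _).comp (measurable_const_smul ε)).aestronglyMeasurable
  obtain ⟨D₀, hD₀, h0'⟩ := (expBigO_massProd (f := fun i : ι => i.2.1)
    (ρ := fun j (i : ι) => (i.2.2 j : Measure K)) p γ v hε hε1).exists_integral_le μ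
    fun ε ν => hmeas ε ν
  obtain ⟨D₁, hD₁, h1⟩ := (expBigO_massProd_sub_one (f := fun i : ι => i.2.1)
    (ρ := fun j (i : ι) => (i.2.2 j : Measure K)) p γ v hε hε1).exists_integral_le μ
    fun ε ν => (hmeas ε ν).sub aestronglyMeasurable_const
  obtain ⟨D₃, hD₃, h3⟩ := (expBigO_massProd_sub (f := fun i : ι => i.2.1)
    (ρ := fun j (i : ι) => (i.2.2 j : Measure K)) p γ v hε hε1).exists_integral_le μ
    fun ε ν => (hmeas ε ν).sub
      (integral_secondOrder_massProd μ p γ h0 v hv ε fun j => (ν j : Measure K)).1.aestronglyMeasurable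
  refine ⟨max D₁ D₃, hD₁.trans (le_max_left _ _), fun ε hε0 hε1' ν _ => ?_⟩
  let e : Set.Ioc (0 : ℝ) 1 := ⟨ε, hε0, hε1'⟩
  let ν' : Fin n → ProbabilityMeasure K := fun j => ⟨ν j, inferInstance⟩
  have hint : Integrable (fun f => massProd p γ ν (ε ^ 2 • v) (ε • f)) μ := (h0' e ν').1
  refine ⟨hint, ?_, ?_⟩
  · have h := (h1 e ν').2
    change |∫ f, (massProd p γ ν (ε ^ 2 • v) (ε • f) - 1) ∂μ| ≤ D₁ * ε ^ 1 at h
    rw [integral_sub hint (integrable_const _), integral_const, probReal_univ, one_smul,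
      pow_one] at h
    exact h.trans (by gcongr; exact le_max_left _ _)
  · have h := (h3 e ν').2
    change |∫ f, (massProd p γ ν (ε ^ 2 • v) (ε • f)
      - (1 + ε * ∑ j, p j * (γ j * ∫ x, f x ∂ν j)
        + ε ^ 2 * (∑ j, p j * (γ j ^ 2 / 2 * ∫ x, (f x ^ 2 - v x) ∂ν j
            - γ j ^ 2 / 2 * (∫ x, f x ∂ν j) ^ 2)
          + (∑ j, p j * (γ j * ∫ x, f x ∂ν j)) ^ 2 / 2))) ∂μ| ≤ D₃ * ε ^ 3 at h
    obtain ⟨hW, hW'⟩ := integral_secondOrder_massProd μ p γ h0 v hv ε ν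
    rw [integral_sub hint hW, hW'] at h
    exact h.trans (by gcongr; exact le_max_right _ _)

/-- Comparison of two Gaussian measures at small scale, uniformly in the measures. -/
theorem exists_integral_massProd_le (h0 : ∀ x, ∫ f, f x ∂μ = 0) (v : C(K, ℝ))
    (hv : ∀ x, v x = ∫ f, f x ^ 2 ∂μ) (μ' : Measure C(K, ℝ)) [IsGaussian μ']
    (h0' : ∀ x, ∫ f, f x ∂μ' = 0) (v' : C(K, ℝ)) (hv' : ∀ x, v' x = ∫ f, f x ^ 2 ∂μ') {A : ℝ}
    (hA0 : 0 ≤ A) (hA : ∀ x y, |(∫ f, f x * f y ∂μ) - ∫ f, f x * f y ∂μ'| ≤ A) :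
    ∃ ε₀ : ℝ, 0 < ε₀ ∧ ε₀ ≤ 1 ∧ ∀ ε : ℝ, 0 < ε → ε ≤ ε₀ → ∀ (ν : Fin n → Measure K)
      [∀ j, IsProbabilityMeasure (ν j)],
      ∫ f, massProd p γ ν (ε ^ 2 • v) (ε • f) ∂μ ≤
        (1 + (((∑ i, ∑ j, |p i * γ i * (p j * γ j)| * A) + ∑ j, |p j * γ j ^ 2| * A) + 2) * ε ^ 2)
          * ∫ f, massProd p γ ν (ε ^ 2 • v') (ε • f) ∂μ' := by
  obtain ⟨D, hD, h⟩ := exists_abs_integral_massProd_sub_le μ p γ h0 v hv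
  obtain ⟨D', hD', h'⟩ := exists_abs_integral_massProd_sub_le μ' p γ h0' v' hv'
  set κ := (∑ i, ∑ j, |p i * γ i * (p j * γ j)| * A) + ∑ j, |p j * γ j ^ 2| * A with hκ
  have hκ0 : 0 ≤ κ := by positivity
  have hS : 0 < 1 + D + 2 * D' := by positivity
  -- This `ε₀` makes the two cubic errors together at most `ε²` and keeps `I'` at least `1/2`.
  refine ⟨1 / (1 + D + 2 * D'), by positivity, ?_, fun ε hε hεle ν _ => ?_⟩
  · rw [div_le_one hS]; linarith
  have hε1 : ε * (1 + D + 2 * D') ≤ 1 := (le_div_iff₀ hS).1 hεle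
  have hε1' : ε ≤ 1 := by nlinarith
  have hεD : (D + D') * ε ≤ 1 := by nlinarith
  have hεD' : D' * ε ≤ 1 / 2 := by nlinarith
  have a1 := (abs_le.1 (h ε hε hε1' ν).2.2).2
  have a2 := (abs_le.1 (h' ε hε hε1' ν).2.2).1
  have a3 := (abs_le.1 (h' ε hε hε1' ν).2.1).1
  have a4 := massProdCoeff_sub_le μ p γ μ' hA ν
  rw [← hκ] at a4
  set I := ∫ f, massProd p γ ν (ε ^ 2 • v) (ε • f) ∂μ
  set I' := ∫ f, massProd p γ ν (ε ^ 2 • v') (ε • f) ∂μ'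
  have hI' : 1 / 2 ≤ I' := by linarith
  have b1 : (D + D') * ε ^ 3 ≤ ε ^ 2 := by
    have := mul_le_mul_of_nonneg_right hεD (sq_nonneg ε)
    linarith
  have b2 := mul_le_mul_of_nonneg_left a4 (sq_nonneg ε)
  -- The additive excess `(κ/2 + 1) ε²` is turned into a multiple of `I'`, at the cost of a factor
  -- two.
  have b3 : (κ + 2) * ε ^ 2 * (1 / 2) ≤ (κ + 2) * ε ^ 2 * I' := by gcongr
  linarith

end Expectation

/-! ### Exchange of increments and iteration -/

/-- Exchanging a small independent Gaussian increment in a two-parameter Gaussian sum. -/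
theorem lintegral_lintegral_sqrt_add_le {E : Type*} [NormedAddCommGroup E] [NormedSpace ℝ E]
    [MeasurableSpace E] [BorelSpace E] [SecondCountableTopology E] [CompleteSpace E]
    (μ μ' : Measure E) [IsGaussian μ] [IsGaussian μ'] (h0 : μ[id] = 0) (h0' : μ'[id] = 0)
    {G G' : E → ENNReal} (hG : Measurable G) (hG' : Measurable G') {c : ENNReal} {ε s t : ℝ}
    (hε : 0 ≤ ε) (hs : 0 ≤ s) (ht : 0 ≤ t)
    (h : ∀ z, ∫⁻ f, G (z + ε • f) ∂μ ≤ c * ∫⁻ f, G' (z + ε • f) ∂μ') :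
    ∫⁻ f, ∫⁻ g, G (√(s + ε ^ 2) • f + √t • g) ∂μ' ∂μ ≤
      c * ∫⁻ f, ∫⁻ g, G' (√s • f + √(t + ε ^ 2) • g) ∂μ' ∂μ := by
  have hm : ∀ {H : E → ENNReal}, Measurable H → ∀ a b c : ℝ,
      Measurable fun q : (E × E) × E => H (a • q.1.1 + b • q.1.2 + c • q.2) := by
    intro H hH a b c
    fun_prop
  have hi : ∀ {H : E → ENNReal}, Measurable H → ∀ a b c : ℝ,
      Measurable fun q : E × E => ∫⁻ g, H (a • q.1 + b • q.2 + c • g) ∂μ' := fun hH a b c =>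
    (hm hH a b c).lintegral_prod_right'
  calc ∫⁻ f, ∫⁻ g, G (√(s + ε ^ 2) • f + √t • g) ∂μ' ∂μ
      = ∫⁻ g, ∫⁻ f, G (√(s + ε ^ 2) • f + √t • g) ∂μ ∂μ' :=
        lintegral_lintegral_swap (Measurable.aemeasurable (by unfold Function.uncurry; fun_prop))
    _ = ∫⁻ g, ∫⁻ f, ∫⁻ f', G ((√s • f + √t • g) + ε • f') ∂μ ∂μ ∂μ' := by
        refine lintegral_congr fun g => ?_
        rw [lintegral_eq_lintegral_lintegral_sqrt μ h0 (G := fun f => G (f + √t • g))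
          (by fun_prop) hs (sq_nonneg ε), Real.sqrt_sq hε]
        simp only [add_right_comm]
    -- The hypothesis is applied with `z = √s • f + √t • g` frozen.
    _ ≤ ∫⁻ g, ∫⁻ f, c * ∫⁻ g', G' ((√s • f + √t • g) + ε • g') ∂μ' ∂μ ∂μ' :=
        lintegral_mono fun g => lintegral_mono fun f => h _
    _ = ∫⁻ f, ∫⁻ g, c * ∫⁻ g', G' ((√s • f + √t • g) + ε • g') ∂μ' ∂μ' ∂μ := by
        refine (lintegral_lintegral_swap (f := fun f g => c * ∫⁻ g', G' ((√s • f + √t • g)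
          + ε • g') ∂μ') ?_).symm
        exact ((hi hG' _ _ _).const_mul c).aemeasurable
    _ = ∫⁻ f, c * ∫⁻ g, ∫⁻ g', G' ((√s • f + √t • g) + ε • g') ∂μ' ∂μ' ∂μ := by
        refine lintegral_congr fun f => lintegral_const_mul c ?_
        exact (hi hG' _ _ _).comp (measurable_const.prodMk measurable_id)
    _ = c * ∫⁻ f, ∫⁻ g, ∫⁻ g', G' ((√s • f + √t • g) + ε • g') ∂μ' ∂μ' ∂μ :=
        lintegral_const_mul c (hi hG' _ _ _).lintegral_prod_right'
    _ = c * ∫⁻ f, ∫⁻ g, G' (√s • f + √(t + ε ^ 2) • g) ∂μ' ∂μ := by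
        congr 1
        refine lintegral_congr fun f => ?_
        rw [lintegral_eq_lintegral_lintegral_sqrt μ' h0' (G := fun g => G' (√s • f + g))
          (by fun_prop) ht (sq_nonneg ε), Real.sqrt_sq hε]
        simp only [add_assoc]

section Comparison

variable {K : Type*} [MetricSpace K] [CompactSpace K] [MeasurableSpace K] [BorelSpace K]
  {n : ℕ} (p γ : Fin n → ℝ) (ρ : Fin n → Measure K)

omit [CompactSpace K] [BorelSpace K] in
theorem massProd_nonneg (v f : C(K, ℝ)) : 0 ≤ massProd p γ ρ v f :=
  Finset.prod_nonneg fun _ _ => Real.rpow_nonneg (integral_nonneg fun _ => (Real.exp_pos _).le) _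

variable [∀ j, IsFiniteMeasure (ρ j)] [∀ j, NeZero (ρ j)]

/-- The frozen part `z` is a density; normalizing it gives the tilted measure, and the normalizing
constants form the first factor. -/
theorem massProd_add (a v z f : C(K, ℝ)) :
    massProd p γ ρ (a + v) (z + f) = massProd p γ ρ a z *
      massProd p γ (fun j => (ρ j).tilted fun x => γ j * z x - γ j ^ 2 / 2 * a x) v f := by
  simp only [massProd]
  rw [← Finset.prod_mul_distrib]
  refine Finset.prod_congr rfl fun j _ => ?_
  rw [← Real.mul_rpow (integral_nonneg fun _ => (Real.exp_pos _).le)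
    (integral_nonneg fun _ => (Real.exp_pos _).le), integral_exp_tilted,
    mul_div_cancel₀ _ (integral_exp_pos' (ρ j) (by fun_prop)).ne']
  congr 2
  ext x
  simp only [ContinuousMap.add_apply, Pi.add_apply]
  congr 1
  ring

theorem isProbabilityMeasure_tilted_of_continuous (j : Fin n) (a z : C(K, ℝ)) :
    IsProbabilityMeasure ((ρ j).tilted fun x => γ j * z x - γ j ^ 2 / 2 * a x) :=
  isProbabilityMeasure_tilted (integrable_of_continuous_of_compactSpace _ (by fun_prop))

variable [MeasurableSpace C(K, ℝ)] [BorelSpace C(K, ℝ)] (μ μ' : Measure C(K, ℝ)) [IsGaussian μ]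
  [IsGaussian μ']

theorem integrable_massProd (h0 : ∀ x, ∫ f, f x ∂μ = 0) (v : C(K, ℝ))
    (hv : ∀ x, v x = ∫ f, f x ^ 2 ∂μ) : Integrable (massProd p γ ρ v) μ := by
  obtain ⟨D, -, h⟩ := exists_abs_integral_massProd_sub_le μ p γ h0 v hv
  -- Tilting by zero normalizes `ρ j` to a probability measure, so the case `ε = 1` applies.
  have := fun j => isProbabilityMeasure_tilted_of_continuous γ ρ j 0 0
  have h1 := ((h 1 one_pos le_rfl
    (fun j => (ρ j).tilted fun x => γ j * (0 : C(K, ℝ)) x - γ j ^ 2 / 2 * (0 : C(K, ℝ)) x)).1).const_mul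
      (massProd p γ ρ 0 0)
  simp only [one_pow, one_smul, ← massProd_add, zero_add] at h1
  exact h1

/-- Comparison of expected products of masses for centered Gaussian measures on `C(K, ℝ)`. -/
theorem integral_massProd_le (h0 : ∀ x, ∫ f, f x ∂μ = 0) (v : C(K, ℝ))
    (hv : ∀ x, v x = ∫ f, f x ^ 2 ∂μ) (h0' : ∀ x, ∫ f, f x ∂μ' = 0) (v' : C(K, ℝ))
    (hv' : ∀ x, v' x = ∫ f, f x ^ 2 ∂μ') {A : ℝ} (hA0 : 0 ≤ A)
    (hA : ∀ x y, |(∫ f, f x * f y ∂μ) - ∫ f, f x * f y ∂μ'| ≤ A) :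
    ∫ f, massProd p γ ρ v f ∂μ ≤ Real.exp ((∑ i, ∑ j, |p i * γ i * (p j * γ j)| * A)
      + ∑ j, |p j * γ j ^ 2| * A + 2) * ∫ f, massProd p γ ρ v' f ∂μ' := by
  obtain ⟨ε₀, hε₀, hε₀1, hstep⟩ := exists_integral_massProd_le μ p γ h0 v hv μ' h0' v' hv' hA0 hA
  obtain ⟨D, -, hD⟩ := exists_abs_integral_massProd_sub_le μ p γ h0 v hv
  obtain ⟨D', -, hD'⟩ := exists_abs_integral_massProd_sub_le μ' p γ h0' v' hv'
  set κ := (∑ i, ∑ j, |p i * γ i * (p j * γ j)| * A) + ∑ j, |p j * γ j ^ 2| * A + 2 with hκ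
  have hκ0 : 0 ≤ κ := by positivity
  -- Extended nonnegative values avoid integrability questions for the mixed fields.
  let G : C(K, ℝ) → C(K, ℝ) → ENNReal := fun a f => ENNReal.ofReal (massProd p γ ρ a f)
  have hG : ∀ a, Measurable (G a) := fun a => (measurable_massProd p γ ρ a).ennreal_ofReal
  obtain ⟨N, hN⟩ := exists_nat_gt (1 / ε₀ ^ 2)
  have hN0 : (0 : ℝ) < N := lt_trans (by positivity) hN
  set ε := √(1 / N) with hε
  have hεpos : 0 < ε := Real.sqrt_pos.2 (by positivity)
  have hεsq : ε ^ 2 = 1 / N := Real.sq_sqrt (by positivity)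
  have hεle : ε ≤ ε₀ := by
    rw [hε, Real.sqrt_le_left hε₀.le]
    exact ((one_div_lt (by positivity) hN0).1 hN).le
  have hG1 : ∀ a z : C(K, ℝ), ∫⁻ f, G (a + ε ^ 2 • v) (z + ε • f) ∂μ ≤
      ENNReal.ofReal (1 + κ * ε ^ 2) * ∫⁻ f, G (a + ε ^ 2 • v') (z + ε • f) ∂μ' := by
    intro a z
    have := fun j => isProbabilityMeasure_tilted_of_continuous γ ρ j a z
    simp only [G, massProd_add, ENNReal.ofReal_mul (massProd_nonneg p γ ρ _ _)]
    rw [lintegral_const_mul' _ _ ENNReal.ofReal_ne_top, lintegral_const_mul' _ _ ENNReal.ofReal_ne_top,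
      ← ofReal_integral_eq_lintegral_ofReal (hD ε hεpos (hεle.trans hε₀1) _).1
        (Filter.Eventually.of_forall fun f => massProd_nonneg p γ _ _ _),
      ← ofReal_integral_eq_lintegral_ofReal (hD' ε hεpos (hεle.trans hε₀1) _).1
        (Filter.Eventually.of_forall fun f => massProd_nonneg p γ _ _ _),
      mul_left_comm, ← ENNReal.ofReal_mul (p := 1 + κ * ε ^ 2) (by positivity)]
    gcongr
    exact hstep ε hεpos hεle _
  -- The mixed field has a share `k/N` of its variance from `μ` and the rest from `μ'`; the
  -- normalization is interpolated likewise.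
  let Φ : ℕ → ENNReal := fun k => ∫⁻ f, ∫⁻ g, G (((k : ℝ) / N) • v + (((N : ℝ) - k) / N) • v')
    (√((k : ℝ) / N) • f + √(((N : ℝ) - k) / N) • g) ∂μ' ∂μ
  have hΦ : ∀ k, k < N → Φ (k + 1) ≤ ENNReal.ofReal (1 + κ * ε ^ 2) * Φ k := by
    intro k hk
    have hk' : (k : ℝ) + 1 ≤ N := by exact_mod_cast hk
    have e1 : ((k + 1 : ℕ) : ℝ) / N = k / N + ε ^ 2 := by rw [hεsq]; push_cast; ring
    have e2 : ((N : ℝ) - k) / N = ((N : ℝ) - (k + 1 : ℕ)) / N + ε ^ 2 := by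
      rw [hεsq]; push_cast; ring
    simp only [Φ]
    rw [e1, e2]
    refine lintegral_lintegral_sqrt_add_le μ μ' (integral_id_eq_zero_of_forall_eval μ h0)
      (integral_id_eq_zero_of_forall_eval μ' h0') (hG _) (hG _) hεpos.le (by positivity)
      (div_nonneg (by push_cast; linarith) hN0.le) fun z => ?_
    have := hG1 (((k : ℝ) / N) • v + (((N : ℝ) - (k + 1 : ℕ)) / N) • v') z
    rwa [add_right_comm, ← add_smul, add_assoc, ← add_smul] at this
  have hiter : ∀ k, k ≤ N → Φ k ≤ ENNReal.ofReal (1 + κ * ε ^ 2) ^ k * Φ 0 := by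
    intro k
    induction k with
    | zero => intro _; simp
    | succ k ih =>
      intro hk
      refine (hΦ k hk).trans ?_
      rw [pow_succ' _ k, mul_assoc]
      gcongr
      exact ih (by omega)
  have hΦN : Φ N = ENNReal.ofReal (∫ f, massProd p γ ρ v f ∂μ) := by
    rw [ofReal_integral_eq_lintegral_ofReal (integrable_massProd p γ ρ μ h0 v hv)
      (Filter.Eventually.of_forall fun f => massProd_nonneg p γ _ _ _)]
    simp [Φ, G, div_self hN0.ne', -Real.sqrt_div, -Real.sqrt_div']
  have hΦ0 : Φ 0 = ENNReal.ofReal (∫ f, massProd p γ ρ v' f ∂μ') := by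
    rw [ofReal_integral_eq_lintegral_ofReal (integrable_massProd p γ ρ μ' h0' v' hv')
      (Filter.Eventually.of_forall fun f => massProd_nonneg p γ _ _ _)]
    simp [Φ, G, div_self hN0.ne', -Real.sqrt_div, -Real.sqrt_div']
  have hfin := hiter N le_rfl
  rw [hΦN, hΦ0, ← ENNReal.ofReal_pow (by positivity), ← ENNReal.ofReal_mul (by positivity)] at hfin
  have hI' : 0 ≤ ∫ f, massProd p γ ρ v' f ∂μ' := integral_nonneg fun f => massProd_nonneg p γ _ _ _
  refine ((ENNReal.ofReal_le_ofReal_iff (by positivity)).1 hfin).trans ?_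
  gcongr
  calc (1 + κ * ε ^ 2) ^ N ≤ Real.exp (κ * ε ^ 2) ^ N := by
        gcongr
        linarith [Real.add_one_le_exp (κ * ε ^ 2)]
    _ = Real.exp κ := by
        rw [← Real.exp_nat_mul, hεsq]
        congr 1
        field_simp

end Comparison

/-! ### Return to the fields and degenerate measures -/

/-- The expected product of masses of a continuous Gaussian field, computed from its law on
`C(K, ℝ)`. -/
theorem IsContinuousGaussianField.exists_law {K Ω : Type*} [MetricSpace K] [CompactSpace K]
    [MeasurableSpace K] [BorelSpace K] [MeasurableSpace C(K, ℝ)] [BorelSpace C(K, ℝ)]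
    [MeasurableSpace Ω] {P : Measure Ω} [IsProbabilityMeasure P] {X : K → Ω → ℝ}
    (hX : IsContinuousGaussianField X P) :
    ∃ (μ : Measure C(K, ℝ)) (v : C(K, ℝ)), IsGaussian μ ∧ (∀ x, ∫ f, f x ∂μ = 0) ∧
      (∀ x, v x = ∫ f, f x ^ 2 ∂μ) ∧ (∀ x y, ∫ f, f x * f y ∂μ = ∫ ω, X x ω * X y ω ∂P) ∧
      ∀ {n : ℕ} (p γ : Fin n → ℝ) (ρ : Fin n → Measure K) [∀ j, IsFiniteMeasure (ρ j)],
        (Integrable (massProd p γ ρ v) μ → Integrable (expMassProd P X γ p ρ) P) ∧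
        ∫ f, massProd p γ ρ v f ∂μ = ∫ ω, expMassProd P X γ p ρ ω ∂P := by
  obtain ⟨φ, hφ, hφX, hμ, h0⟩ := hX.exists_path
  have hcov : ∀ x y, ∫ f : C(K, ℝ), f x * f y ∂(P.map φ) = ∫ ω, X x ω * X y ω ∂P := by
    intro x y
    rw [integral_map hφ (integrable_eval_mul_eval _ x y).aestronglyMeasurable]
    refine integral_congr_ae ?_
    filter_upwards [hφX] with ω hω
    rw [hω, hω]
  refine ⟨P.map φ, ⟨_, continuous_integral_eval_sq (P.map φ)⟩, hμ, h0, fun _ => rfl, hcov,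
    fun {n} p γ ρ _ => ?_⟩
  set v : C(K, ℝ) := ⟨_, continuous_integral_eval_sq (P.map φ)⟩ with hv
  have hvX : ∀ x, ∫ ω, X x ω ^ 2 ∂P = v x := by
    intro x
    simp only [hv, ContinuousMap.coe_mk, sq, hcov]
  have hae : (fun ω => massProd p γ ρ v (φ ω)) =ᵐ[P] expMassProd P X γ p ρ := by
    filter_upwards [hφX] with ω hω
    simp only [expMassProd, expMass, massProd, hω, hvX]
  have hm := (measurable_massProd p γ ρ v).aestronglyMeasurable (μ := P.map φ)
  exact ⟨fun h => ((integrable_map_measure hm hφ).1 h).congr hae,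
    (integral_map hφ hm).trans (integral_congr_ae hae)⟩

/-- Comparison of expected products of exponential masses of two continuous Gaussian fields on a
compact metric space, for nonzero measures. -/
theorem IsContinuousGaussianField.integral_expMassProd_le {K : Type*} [MetricSpace K]
    [CompactSpace K] [MeasurableSpace K] [BorelSpace K] {n : ℕ} (p γ : Fin n → ℝ)
    (ρ : Fin n → Measure K) [∀ j, IsFiniteMeasure (ρ j)] [∀ j, NeZero (ρ j)]
    {Ω Ω' : Type*} [MeasurableSpace Ω] [MeasurableSpace Ω'] {P : Measure Ω} {P' : Measure Ω'}
    [IsProbabilityMeasure P] [IsProbabilityMeasure P'] {X : K → Ω → ℝ} {Y : K → Ω' → ℝ}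
    (hX : IsContinuousGaussianField X P) (hY : IsContinuousGaussianField Y P') {A : ℝ}
    (hA0 : 0 ≤ A)
    (hA : ∀ x y : K, |(∫ ω, X x ω * X y ω ∂P) - ∫ ω, Y x ω * Y y ω ∂P'| ≤ A) :
    Integrable (expMassProd P X γ p ρ) P ∧ Integrable (expMassProd P' Y γ p ρ) P' ∧
      ∫ ω, expMassProd P X γ p ρ ω ∂P ≤ Real.exp ((∑ i, ∑ j, |p i * γ i * (p j * γ j)| * A)
        + ∑ j, |p j * γ j ^ 2| * A + 2) * ∫ ω, expMassProd P' Y γ p ρ ω ∂P' := by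
  borelize C(K, ℝ)
  obtain ⟨μ, v, hμ, h0, hv, hcov, hprod⟩ := hX.exists_law
  obtain ⟨μ', v', hμ', h0', hv', hcov', hprod'⟩ := hY.exists_law
  refine ⟨(hprod p γ ρ).1 (integrable_massProd p γ ρ μ h0 v hv),
    (hprod' p γ ρ).1 (integrable_massProd p γ ρ μ' h0' v' hv'), ?_⟩
  rw [← (hprod p γ ρ).2, ← (hprod' p γ ρ).2]
  exact integral_massProd_le p γ ρ μ μ' h0 v hv h0' v' hv' hA0 fun x y => by
    rw [hcov, hcov']
    exact hA x y

theorem expMassProd_congr {T Ω : Type*} [MeasurableSpace T] [MeasurableSpace Ω] {n : ℕ}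
    (P : Measure Ω) (X : T → Ω → ℝ) (γ p : Fin n → ℝ) {μ ρ : Fin n → Measure T}
    (h : ∀ j, μ j = ρ j ∨ p j = 0) : expMassProd P X γ p μ = expMassProd P X γ p ρ := by
  ext ω
  refine Finset.prod_congr rfl fun j _ => ?_
  rcases h j with hj | hj
  · rw [hj]
  · rw [hj, Real.rpow_zero, Real.rpow_zero]

theorem expMassProd_eq_zero {T Ω : Type*} [MeasurableSpace T] [MeasurableSpace Ω] {n : ℕ}
    (P : Measure Ω) (X : T → Ω → ℝ) (γ p : Fin n → ℝ) {μ : Fin n → Measure T} {j : Fin n}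
    (hμ : μ j = 0) (hp : p j ≠ 0) : expMassProd P X γ p μ = 0 := by
  ext ω
  refine Finset.prod_eq_zero (Finset.mem_univ j) ?_
  rw [expMass, hμ, integral_zero_measure, Real.zero_rpow hp]

theorem expMassProd_eq_one {T Ω : Type*} [MeasurableSpace T] [MeasurableSpace Ω] {n : ℕ}
    (P : Measure Ω) (X : T → Ω → ℝ) (γ p : Fin n → ℝ) {μ : Fin n → Measure T}
    (hp : ∀ j, p j = 0) : expMassProd P X γ p μ = 1 := by
  ext ω
  simp [expMassProd, hp]

theorem propositionA2 (n : ℕ) (p γ : Fin n → ℝ) (A : ℝ) (hA : 0 < A) :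
    ∃ C : ℝ, ∀ (d : ℕ) (K : Set (EuclideanSpace ℝ (Fin d))), IsCompact K →
      ∀ (Ω : Type*) [MeasurableSpace Ω] (P : Measure Ω) [IsProbabilityMeasure P]
        (Ω' : Type*) [MeasurableSpace Ω'] (P' : Measure Ω') [IsProbabilityMeasure P']
        (X : K → Ω → ℝ) (Y : K → Ω' → ℝ),
        IsContinuousGaussianField X P → IsContinuousGaussianField Y P' →
        (∀ x y : K, |(∫ ω, X x ω * X y ω ∂P) - ∫ ω, Y x ω * Y y ω ∂P'| ≤ A) →
        ∀ (μ : Fin n → Measure K), (∀ j, IsFiniteMeasure (μ j)) →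
          Integrable (expMassProd P X γ p μ) P ∧
          Integrable (expMassProd P' Y γ p μ) P' ∧
          ∫ ω, expMassProd P X γ p μ ω ∂P ≤ C * ∫ ω, expMassProd P' Y γ p μ ω ∂P' := by
  refine ⟨Real.exp ((∑ i, ∑ j, |p i * γ i * (p j * γ j)| * A) + ∑ j, |p j * γ j ^ 2| * A + 2),
    fun d K hK Ω _ P _ Ω' _ P' _ X Y hX hY hXY μ hμ => ?_⟩
  have : CompactSpace K := isCompact_iff_compactSpace.1 hK
  -- In this case both products vanish identically, also for `p j < 0`, since `0 ^ p = 0` for every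
  -- `p ≠ 0`.
  by_cases hzero : ∃ j, μ j = 0 ∧ p j ≠ 0
  · obtain ⟨j, hj, hpj⟩ := hzero
    rw [expMassProd_eq_zero P X γ p hj hpj, expMassProd_eq_zero P' Y γ p hj hpj]
    simp
  have hzero' : ∀ j, μ j = 0 → p j = 0 := fun j hj => by_contra fun hp => hzero ⟨j, hj, hp⟩
  rcases isEmpty_or_nonempty K with hKe | ⟨⟨x₀⟩⟩
  · have hp : ∀ j, p j = 0 := fun j => hzero' j (Measure.eq_zero_of_isEmpty _)
    rw [expMassProd_eq_one P X γ p hp, expMassProd_eq_one P' Y γ p hp]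
    refine ⟨integrable_const (1 : ℝ), integrable_const (1 : ℝ), ?_⟩
    simpa using Real.one_le_exp (by positivity :
      0 ≤ (∑ i, ∑ j, |p i * γ i * (p j * γ j)| * A) + ∑ j, |p j * γ j ^ 2| * A + 2)
  · classical
    -- A zero measure now carries exponent zero, so a Dirac mass may replace it; this is why empty
    -- `K` was treated apart.
    let ρ : Fin n → Measure K := fun j => if μ j = 0 then Measure.dirac x₀ else μ j
    have hμρ : ∀ j, μ j = ρ j ∨ p j = 0 := fun j => by
      by_cases hj : μ j = 0
      · exact Or.inr (hzero' j hj)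
      · exact Or.inl (if_neg hj).symm
    have hρ : ∀ j, IsFiniteMeasure (ρ j) ∧ NeZero (ρ j) := fun j => by
      by_cases hj : μ j = 0
      · simp only [ρ, if_pos hj]
        exact ⟨inferInstance, inferInstance⟩
      · simp only [ρ, if_neg hj]
        exact ⟨hμ j, ⟨hj⟩⟩
    have := fun j => (hρ j).1
    have := fun j => (hρ j).2
    rw [expMassProd_congr P X γ p hμρ, expMassProd_congr P' Y γ p hμρ]
    exact hX.integral_expMassProd_le p γ ρ hY hA.le hXY
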